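/- For a fixed real number $T$, the problem T-PCUT is the following. An instance consists of a finite directed graph $G=(V,E)$ with vertex costs $c:V\to\mathbb{R}_{>0}$, edge lengths $d:E\to\mathbb{R}_{>0}$, and a pair $(s,t)$ of vertices. A \emph{$T$-pseudocut} is a set $W\subseteq V\setminus\{s,t\}$ such that, after the removal of $W$ from $G$, the $d$-weighted directed shortest-path distance from $s$ to $t$ exceeds $T$ (the distance being $\infty$ if there is no directed path from $s$ to $t$). The task is to output a $T$-pseudocut $W$ of minimum total cost $\sum_{v\in W}c(v)$, or to report that no $T$-pseudocut exists. \textbf{Proposition.} For every constant $T\le 3$, T-PCUT restricted to instances with uniform lengths ($d(e)=1$ for every $e\in E$) and uniform costs ($c(v)=1$ for every $v\in V$) is solvable in polynomial time: there is a program for a random access machine (unit-cost instructions, with addition and truncated subtraction as its only arithmetic operations) and a polynomial $p$ such that, on every such instance, given by the number $|V|$, the names of $s$ and $t$, and the adjacency matrix of $G$, the program halts with a correct answer after at most $p(N)$ steps, where $N$ is the bit size of the input. -/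

import Mathlib

/-! ## A random access machine with a step count

The machine has registers `reg 0, reg 1, …` (a program mentions finitely many of them) and a
memory `mem 0, mem 1, …` reached by indirect addressing. All cells hold natural numbers. The
only arithmetic operations are addition and truncated subtraction, so that counting one step for
every instruction and every test is polynomially equivalent to Turing machine time. -/

namespace RAM

/-- The contents of the registers and of the memory. -/
structure State where
  reg : ℕ → ℕ
  mem : ℕ → ℕ

/-- Programs of the random access machine. -/
inductive Program where
  /-- do nothing -/
  | skip : Program
  /-- `reg i := a` -/
  | const (i a : ℕ) : Program
  /-- `reg i := reg j + reg k` -/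
  | add (i j k : ℕ) : Program
  /-- `reg i := reg j - reg k`, truncated at `0` -/
  | sub (i j k : ℕ) : Program
  /-- `reg i := mem (reg j)` -/
  | load (i j : ℕ) : Program
  /-- `mem (reg i) := reg j` -/
  | store (i j : ℕ) : Program
  /-- run the first program, then the second one -/
  | seq (P Q : Program) : Program
  /-- run the first program if `reg i ≠ 0`, the second one if `reg i = 0` -/
  | ifNonzero (i : ℕ) (P Q : Program) : Program
  /-- repeat the program as long as `reg i ≠ 0` -/
  | whileNonzero (i : ℕ) (P : Program) : Program

/-- `Exec P σ τ k`: started in the state `σ`, the program `P` halts in the state `τ` after exactly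
`k` steps, where every elementary instruction and every test of a register takes one step. -/
inductive Exec : Program → State → State → ℕ → Prop where
  | skip (σ : State) : Exec .skip σ σ 1
  | const (σ : State) (i a : ℕ) :
      Exec (.const i a) σ ⟨Function.update σ.reg i a, σ.mem⟩ 1
  | add (σ : State) (i j k : ℕ) :
      Exec (.add i j k) σ ⟨Function.update σ.reg i (σ.reg j + σ.reg k), σ.mem⟩ 1
  | sub (σ : State) (i j k : ℕ) :
      Exec (.sub i j k) σ ⟨Function.update σ.reg i (σ.reg j - σ.reg k), σ.mem⟩ 1
  | load (σ : State) (i j : ℕ) :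
      Exec (.load i j) σ ⟨Function.update σ.reg i (σ.mem (σ.reg j)), σ.mem⟩ 1
  | store (σ : State) (i j : ℕ) :
      Exec (.store i j) σ ⟨σ.reg, Function.update σ.mem (σ.reg i) (σ.reg j)⟩ 1
  | seq {P Q : Program} {σ τ υ : State} {k l : ℕ} :
      Exec P σ τ k → Exec Q τ υ l → Exec (.seq P Q) σ υ (k + l)
  | ifTrue {i : ℕ} {P Q : Program} {σ τ : State} {k : ℕ} :
      σ.reg i ≠ 0 → Exec P σ τ k → Exec (.ifNonzero i P Q) σ τ (k + 1)
  | ifFalse {i : ℕ} {P Q : Program} {σ τ : State} {k : ℕ} :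
      σ.reg i = 0 → Exec Q σ τ k → Exec (.ifNonzero i P Q) σ τ (k + 1)
  | whileDone {i : ℕ} {P : Program} {σ : State} :
      σ.reg i = 0 → Exec (.whileNonzero i P) σ σ 1
  | whileStep {i : ℕ} {P : Program} {σ τ υ : State} {k l : ℕ} :
      σ.reg i ≠ 0 → Exec P σ τ k → Exec (.whileNonzero i P) τ υ l →
        Exec (.whileNonzero i P) σ υ (k + l + 1)

/-- The initial state on an input word: the word stands at the beginning of the memory, its length
in register `0`, and all other cells hold `0`. -/
def initial (w : List ℕ) : State where
  reg := Function.update (fun _ => 0) 0 w.length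
  mem := fun a => w.getD a 0

/-- The output read off a final state: the first `reg 0` cells of the memory. -/
def output (σ : State) : List ℕ := (List.range (σ.reg 0)).map σ.mem

/-- The size of an input word: the total number of binary digits of its entries, plus one for
each entry as a separator. -/
def wordSize (w : List ℕ) : ℕ := (w.map fun a => Nat.size a + 1).sum

/-- A search problem, given by its instances `α`, the candidate answers `β x` to each instance
`x`, the relation of being a correct answer, and encodings of instances and answers as words, is
solvable in polynomial time if some program, on every instance `x`, halts within a number of steps
that is bounded by a polynomial in the size of the encoding of `x`, with (the encoding of) a
correct answer as its output. -/
def SolvableInPolyTime {α : Type} {β : α → Type} (correct : ∀ x, β x → Prop)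
    (encodeInput : α → List ℕ) (encodeAnswer : ∀ x, β x → List ℕ) : Prop :=
  ∃ (P : Program) (p : Polynomial ℕ), ∀ x : α, ∃ (τ : State) (k : ℕ),
    Exec P (initial (encodeInput x)) τ k ∧
    k ≤ p.eval (wordSize (encodeInput x)) ∧
    ∃ y : β x, correct x y ∧ output τ = encodeAnswer x y

end RAM

/-! ## The minimum pseudocut problem -/

/-- An instance of the pseudocut problem: a finite directed graph, given on the vertices
`0, …, n - 1`, with positive vertex costs, positive edge lengths and a pair of vertices. Only the
values of `len` on edges are relevant. -/
structure PCutInstance where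
  n : ℕ
  G : Digraph (Fin n)
  cost : Fin n → ℝ
  cost_pos : ∀ v, 0 < cost v
  len : Fin n → Fin n → ℝ
  len_pos : ∀ u v, G.Adj u v → 0 < len u v
  s : Fin n
  t : Fin n

namespace PCutInstance

/-- All vertices have cost `1`. -/
def UniformCosts (I : PCutInstance) : Prop := ∀ v, I.cost v = 1

/-- All edges have length `1`. -/
def UniformLengths (I : PCutInstance) : Prop := ∀ u v, I.G.Adj u v → I.len u v = 1

/-- `p` is the vertex sequence of a directed path from `u` to `v` in the graph that is left after
the removal of the vertices in `W`. -/
def IsPathAvoiding (I : PCutInstance) (W : Finset (Fin I.n)) (u v : Fin I.n)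
    (p : List (Fin I.n)) : Prop :=
  p.head? = some u ∧ p.getLast? = some v ∧ p.IsChain I.G.Adj ∧ ∀ x ∈ p, x ∉ W

/-- The length of a path: the sum of the lengths of its edges. -/
def pathLength (I : PCutInstance) (p : List (Fin I.n)) : ℝ :=
  (List.zipWith I.len p p.tail).sum

/-- The distance from `u` to `v` after the removal of `W`: the least length of a path from `u` to
`v`, which is `⊤` if there is no such path. -/
noncomputable def distAfter (I : PCutInstance) (W : Finset (Fin I.n)) (u v : Fin I.n) : EReal :=
  ⨅ (p : List (Fin I.n)) (_ : I.IsPathAvoiding W u v p), ((I.pathLength p : ℝ) : EReal)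

/-- `W` is a `T`-pseudocut: a set of vertices other than `s` and `t` whose removal makes the
distance from `s` to `t` greater than `T`. -/
def IsPseudocut (I : PCutInstance) (T : ℝ) (W : Finset (Fin I.n)) : Prop :=
  I.s ∉ W ∧ I.t ∉ W ∧ (T : EReal) < I.distAfter W I.s I.t

/-- `W` is a `T`-pseudocut of minimum cost. -/
def IsMinPseudocut (I : PCutInstance) (T : ℝ) (W : Finset (Fin I.n)) : Prop :=
  I.IsPseudocut T W ∧ ∀ W', I.IsPseudocut T W' → ∑ v ∈ W, I.cost v ≤ ∑ v ∈ W', I.cost v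

/-- Correct answers to the problem T-PCUT: a `T`-pseudocut of minimum cost, or the
answer `none` if there is no `T`-pseudocut. -/
def IsAnswer (I : PCutInstance) (T : ℝ) : Option (Finset (Fin I.n)) → Prop
  | some W => I.IsMinPseudocut T W
  | none => ∀ W, ¬ I.IsPseudocut T W

open Classical in
/-- The encoding of an instance without weights: the numbers `n`, `s`, `t`, followed by the rows
of the adjacency matrix (the entry in row `u` and column `v` stands at position `3 + n * u + v`). -/
noncomputable def encode (I : PCutInstance) : List ℕ :=
  I.n :: (I.s : ℕ) :: (I.t : ℕ) ::
    (List.finRange I.n).flatMap fun u =>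
      (List.finRange I.n).map fun v => if I.G.Adj u v then 1 else 0

/-- The encoding of an answer: `0` for `none`, and `1` followed by the characteristic vector of
`W` for a set `W` of vertices. -/
def encodeAnswer (I : PCutInstance) : Option (Finset (Fin I.n)) → List ℕ
  | some W => 1 :: (List.finRange I.n).map fun v => if v ∈ W then 1 else 0
  | none => [0]

end PCutInstance

/-- Instances with uniform lengths and uniform costs. -/
abbrev UniformPCutInstance : Type :=
  { I : PCutInstance // I.UniformLengths ∧ I.UniformCosts }

/-! With unit lengths, a `T`-pseudocut for `T ≤ 3` is a set avoiding `s` and `t` that meets the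
interior of every walk from `s` to `t` with at most `T` edges, hence at most three. Walks with no
edge or one edge have no interior: they can only decide that no pseudocut exists. A walk with two
edges forces its middle vertex into the set. So let `C` be the set of vertices that are both
out-neighbours of `s` and in-neighbours of `t`; it is contained in every solution for `T ≥ 2` and is
itself optimal for `2 ≤ T < 3`.

For `T = 3` the walks `s, u, v, t` that miss `C` correspond to the edges from the out-neighbours of
`s` outside `C` to the in-neighbours of `t` outside `C`. These two sets are disjoint, so a minimum
vertex cover of a bipartite graph has to be added to `C`. König's theorem is made algorithmic by an
auction: a bidder takes a cheapest neighbouring item, raises its price by one and displaces the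
previous owner; a bidder whose neighbours all cost `n + 1` gives up. Every bid raises one of `n`
bounded prices, which gives polynomial time.

At the end, some `k` in `1, …, n + 1` is not a price. From each matched pair take the item if its
price is above `k`, and the owner otherwise. An owner pays at most one more than any neighbouring
item costs, so no edge jumps across the gap, and the chosen vertices form a cover
(`Auction.pick_covers`). It has one vertex per matching edge, so it is minimum (`Auction.card_le`).

The rest is program verification with step bounds (`Runs`), and the translation between pseudocuts
and hitting sets (`isPseudocut_iff`). -/

namespace RAM

/-! ### Program logic with step bounds -/

/-- `σ.set i x` is `σ` with the value `x` written to register `i`. -/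
def State.set (σ : State) (i x : ℕ) : State := ⟨Function.update σ.reg i x, σ.mem⟩

/-- `σ.put a x` is `σ` with the value `x` written to memory cell `a`. -/
def State.put (σ : State) (a x : ℕ) : State := ⟨σ.reg, Function.update σ.mem a x⟩

@[simp] theorem State.set_reg (σ : State) (i x j : ℕ) :
    (σ.set i x).reg j = if j = i then x else σ.reg j := by
  simp [State.set, Function.update_apply]

@[simp] theorem State.set_mem (σ : State) (i x : ℕ) : (σ.set i x).mem = σ.mem := rfl

@[simp] theorem State.put_reg (σ : State) (a x : ℕ) : (σ.put a x).reg = σ.reg := rfl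

theorem State.put_mem (σ : State) (a x : ℕ) :
    (σ.put a x).mem = Function.update σ.mem a x := rfl

/-- Started in `σ`, the program `P` halts after at most `b` steps in a state satisfying `Q`. -/
def Runs (P : Program) (σ : State) (b : ℕ) (Q : State → Prop) : Prop :=
  ∃ τ k, Exec P σ τ k ∧ k ≤ b ∧ Q τ

/-- The sequential composition of a list of programs. -/
def block : List Program → Program
  | [] => .skip
  | P :: l => .seq P (block l)

namespace Runs

variable {P P' : Program} {l : List Program} {σ : State} {b c : ℕ} {Q R : State → Prop}
  {i j k a : ℕ}

theorem mono (h : Runs P σ b Q) (hb : b ≤ c) (hQ : ∀ τ, Q τ → R τ) : Runs P σ c R := by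
  obtain ⟨τ, k, h1, h2, h3⟩ := h
  exact ⟨τ, k, h1, h2.trans hb, hQ τ h3⟩

theorem of_le (h : Runs P σ b Q) (hb : b ≤ c) : Runs P σ c Q := h.mono hb fun _ h => h

theorem nil (h : Q σ) : Runs (block []) σ 1 Q := ⟨σ, 1, .skip σ, le_rfl, h⟩

theorem cons (h : Runs P σ b R) (h' : ∀ τ, R τ → Runs (block l) τ c Q) :
    Runs (block (P :: l)) σ (b + c) Q := by
  obtain ⟨τ, k, h1, h2, h3⟩ := h
  obtain ⟨υ, k', h4, h5, h6⟩ := h' τ h3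
  exact ⟨υ, k + k', .seq h1 h4, by omega, h6⟩

theorem last (h : Runs P σ b Q) : Runs (block [P]) σ (b + 1) Q := cons h fun _ hτ => nil hτ

theorem const (h : Runs (block l) (σ.set i a) b Q) :
    Runs (block (.const i a :: l)) σ (1 + b) Q :=
  cons (R := fun τ => τ = σ.set i a) ⟨_, 1, .const σ i a, le_rfl, rfl⟩ (by rintro τ rfl; exact h)

theorem add (h : Runs (block l) (σ.set i (σ.reg j + σ.reg k)) b Q) :
    Runs (block (.add i j k :: l)) σ (1 + b) Q :=
  cons (R := fun τ => τ = σ.set i (σ.reg j + σ.reg k)) ⟨_, 1, .add σ i j k, le_rfl, rfl⟩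
    (by rintro τ rfl; exact h)

theorem sub (h : Runs (block l) (σ.set i (σ.reg j - σ.reg k)) b Q) :
    Runs (block (.sub i j k :: l)) σ (1 + b) Q :=
  cons (R := fun τ => τ = σ.set i (σ.reg j - σ.reg k)) ⟨_, 1, .sub σ i j k, le_rfl, rfl⟩
    (by rintro τ rfl; exact h)

theorem load (h : Runs (block l) (σ.set i (σ.mem (σ.reg j))) b Q) :
    Runs (block (.load i j :: l)) σ (1 + b) Q :=
  cons (R := fun τ => τ = σ.set i (σ.mem (σ.reg j))) ⟨_, 1, .load σ i j, le_rfl, rfl⟩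
    (by rintro τ rfl; exact h)

theorem store (h : Runs (block l) (σ.put (σ.reg i) (σ.reg j)) b Q) :
    Runs (block (.store i j :: l)) σ (1 + b) Q :=
  cons (R := fun τ => τ = σ.put (σ.reg i) (σ.reg j)) ⟨_, 1, .store σ i j, le_rfl, rfl⟩
    (by rintro τ rfl; exact h)

theorem ite (h : σ.reg i ≠ 0 → Runs P σ b Q) (h' : σ.reg i = 0 → Runs P' σ c Q) :
    Runs (.ifNonzero i P P') σ (max b c + 1) Q := by
  by_cases hi : σ.reg i = 0
  · obtain ⟨τ, k, h1, h2, h3⟩ := h' hi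
    exact ⟨τ, k + 1, .ifFalse hi h1, by omega, h3⟩
  · obtain ⟨τ, k, h1, h2, h3⟩ := h hi
    exact ⟨τ, k + 1, .ifTrue hi h1, by omega, h3⟩

/-- A loop whose invariant carries a strictly decreasing measure. -/
theorem loop (I : ℕ → State → Prop)
    (hI : ∀ m σ, I m σ → σ.reg i ≠ 0 → ∃ m', m = m' + 1 ∧ Runs P σ b (I m'))
    (m : ℕ) (σ : State) (h : I m σ) :
    Runs (.whileNonzero i P) σ (m * (b + 1) + 1) (fun τ => (∃ m', I m' τ) ∧ τ.reg i = 0) := by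
  induction m generalizing σ with
  | zero =>
    by_cases hi : σ.reg i = 0
    · exact ⟨σ, 1, .whileDone hi, by omega, ⟨0, h⟩, hi⟩
    · obtain ⟨m', hm, -⟩ := hI _ _ h hi
      omega
  | succ m ih =>
    by_cases hi : σ.reg i = 0
    · exact ⟨σ, 1, .whileDone hi, by omega, ⟨_, h⟩, hi⟩
    · obtain ⟨m', hm, τ, k, h1, h2, h3⟩ := hI _ _ h hi
      obtain rfl : m = m' := by omega
      obtain ⟨υ, k', h4, h5, h6⟩ := ih τ h3
      refine ⟨υ, k + k' + 1, .whileStep hi h1 h4, ?_, h6⟩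
      rw [Nat.succ_mul]
      omega

end Runs

/-- `countdown c i P` runs `P` with register `c` holding `reg i - 1, …, 0` in turn. -/
def countdown (c i : ℕ) (P : Program) : Program :=
  block [.const c 0, .add c c i, .whileNonzero c (block [.sub c c 1, P])]

/-- The decrement subtracts register 1, so the invariant has to guarantee that this register holds
the constant 1. The body has to hand back the counter unchanged. -/
theorem Runs.countdown {c i b : ℕ} {P : Program} {σ : State} (I : ℕ → State → Prop)
    (h1 : ∀ m σ, I m σ → σ.reg 1 = 1) (hic : i ≠ c)
    (h0 : I (σ.reg i) (σ.set c (σ.reg i)))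
    (hI : ∀ m τ, m < σ.reg i → I (m + 1) τ → τ.reg c = m + 1 →
      Runs P (τ.set c m) b (fun υ => υ.reg c = m ∧ I m υ)) :
    Runs (countdown c i P) σ (σ.reg i * (b + 3) + 4) (I 0) := by
  have key := Runs.loop (i := c) (b := 1 + (b + 1)) (P := block [.sub c c 1, P])
    (fun m τ => m ≤ σ.reg i ∧ τ.reg c = m ∧ I m τ)
    (by
      rintro m τ ⟨hm, hc, hI'⟩ hne
      obtain ⟨m, rfl⟩ : ∃ m', m = m' + 1 := ⟨m - 1, by omega⟩
      refine ⟨m, rfl, Runs.sub ?_⟩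
      rw [hc, h1 _ _ hI', Nat.add_sub_cancel]
      refine Runs.cons (hI m τ hm hI' hc) fun υ hυ => Runs.nil ⟨by omega, hυ⟩)
    (σ.reg i) (σ.set c (σ.reg i)) ⟨le_rfl, by simp, h0⟩
  refine Runs.of_le (Runs.const (Runs.add ?_)) (b := 1 + (1 + (σ.reg i * (b + 3) + 1 + 1))) (by omega)
  refine Runs.cons (R := I 0) ?_ fun τ hτ => Runs.nil hτ
  have : ((σ.set c 0).set c ((σ.set c 0).reg c + (σ.set c 0).reg i)) = σ.set c (σ.reg i) := by
    simp [State.set, hic]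
  rw [this]
  refine key.mono (le_of_eq (by ring)) ?_
  rintro τ ⟨⟨m', h, h', h''⟩, h3⟩
  rwa [← h', h3] at h''

/-- The registers below `m` agree. -/
def Frame (m : ℕ) (σ τ : State) : Prop := ∀ r < m, τ.reg r = σ.reg r

namespace Frame

variable {m m' i x a : ℕ} {σ τ υ : State}

theorem refl (m : ℕ) (σ : State) : Frame m σ σ := fun _ _ => rfl

theorem set (h : Frame m σ τ) (hi : m ≤ i) : Frame m σ (τ.set i x) := fun r hr => by
  rw [State.set_reg, if_neg (by omega), h r hr]

theorem put (h : Frame m σ τ) : Frame m σ (τ.put a x) := h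

theorem trans (h : Frame m σ τ) (h' : Frame m' τ υ) (hm : m ≤ m') : Frame m σ υ :=
  fun r hr => by rw [h' r (by omega), h r hr]

theorem mono (h : Frame m σ τ) (hm : m' ≤ m) : Frame m' σ τ := fun r hr => h r (by omega)

end Frame

end RAM

/-! ### The auction algorithm and König's theorem -/

/-- The invariant of the auction algorithm for bipartite matching in the graph `e` on the numbers
below `n`: `p v` is the price of `v`, at most `N`, and `o v = u + 1` if `u` owns `v`, `o v = 0` if
nobody does. The bidders are the numbers from `c` on; the bidder `cur - 1` is about to bid. -/
structure Auction (e : ℕ → ℕ → Prop) (n N c cur : ℕ) (p o : ℕ → ℕ) : Prop where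
  le : ∀ v < n, p v ≤ N
  own : ∀ v < n, ∀ u, o v = u + 1 → c ≤ u ∧ u < n ∧ e u v
  inj : ∀ v < n, ∀ w < n, o v ≠ 0 → o v = o w → v = w
  ne_cur : ∀ v < n, o v ≠ 0 → o v ≠ cur
  cur_mem : cur ≠ 0 → c < cur ∧ cur ≤ n
  pos : ∀ v < n, p v ≠ 0 → o v ≠ 0
  slack : ∀ v < n, ∀ u, ∀ w < n, o v = u + 1 → e u w → p v ≤ p w + 1
  served : ∀ u, c ≤ u → u < n →
    u + 1 = cur ∨ (∃ v < n, o v = u + 1) ∨ ∀ w < n, e u w → N ≤ p w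

namespace Auction

variable {e : ℕ → ℕ → Prop} {n N c cur : ℕ} {p o : ℕ → ℕ}

theorem init : Auction e n N n 0 (fun _ => 0) (fun _ => 0) where
  le := by simp
  own := by simp
  inj := by simp
  ne_cur := by simp
  cur_mem := by simp
  pos := by simp
  slack := by simp
  served := by intros; omega

theorem enter (h : Auction e n N (c + 1) 0 p o) (hc : c < n) : Auction e n N c (c + 1) p o where
  le := h.le
  own v hv u hu := by have := h.own v hv u hu; exact ⟨by omega, this.2⟩
  inj := h.inj
  ne_cur v hv ho hc' := by have := h.own v hv c hc'; omega
  cur_mem _ := by omega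
  pos := h.pos
  slack := h.slack
  served u hu hn := by
    rcases hu.eq_or_lt with rfl | hu
    · exact .inl rfl
    · exact .inr ((h.served u hu hn).resolve_left (by omega))

/-- Giving up is final: prices never fall, so the last alternative of `served` persists. -/
theorem drop (h : Auction e n N c cur p o) (hu : ∀ w < n, e (cur - 1) w → N ≤ p w) :
    Auction e n N c 0 p o where
  le := h.le
  own := h.own
  inj := h.inj
  ne_cur _ _ h := h
  cur_mem h := absurd rfl h
  pos := h.pos
  slack := h.slack
  served u hc hn := by
    rcases h.served u hc hn with rfl | h
    · exact .inr (.inr hu)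
    · exact .inr h

/-- The old value `o v` already encodes the next bidder: the displaced owner, or 0 if the item was
free. `slack` holds for the new owner because `p v` was minimal among its neighbours, and for the
other owners because the prices they compare with can only rise. -/
theorem bid (h : Auction e n N c cur p o) (h0 : cur ≠ 0) {v : ℕ} (hv : v < n)
    (he : e (cur - 1) v) (hN : p v < N) (hmin : ∀ w < n, e (cur - 1) w → p v ≤ p w) :
    Auction e n N c (o v) (Function.update p v (p v + 1)) (Function.update o v cur) where
  le w hw := by
    have := h.le w hw
    rw [Function.update_apply]; split_ifs <;> omega
  own w hw u hu := by
    rw [Function.update_apply] at hu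
    split_ifs at hu with hwv
    · subst hwv
      have := h.cur_mem h0
      obtain rfl : u = cur - 1 := by omega
      exact ⟨by omega, by omega, he⟩
    · exact h.own w hw u hu
  inj w hw w' hw' hne heq := by
    simp only [Function.update_apply] at hne heq
    have := h.inj w hw w' hw'
    have := h.ne_cur w hw
    have := h.ne_cur w' hw'
    grind
  ne_cur w hw hne heq := by
    simp only [Function.update_apply] at hne heq
    have := h.inj w hw v hv
    have := h.ne_cur v hv
    grind
  cur_mem hne := by
    have := h.own v hv (o v - 1) (by omega)
    omega
  pos w hw hne := by
    have := h.pos w hw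
    simp only [Function.update_apply] at hne ⊢
    grind
  slack w hw u w' hw' hu hew := by
    have h1 := h.slack w hw u w' hw'
    have h2 := hmin w' hw'
    simp only [Function.update_apply] at hu ⊢
    by_cases hwv : w = v
    · subst hwv
      simp only [if_true] at hu ⊢
      have : u = cur - 1 := by omega
      subst this
      have := h2 hew
      split_ifs <;> omega
    · simp only [if_neg hwv] at hu ⊢
      have := h1 hu hew
      split_ifs with hh
      · subst hh; omega
      · omega
  served u hc hn := by
    rcases h.served u hc hn with rfl | ⟨w, hw, ho⟩ | hN'
    · exact .inr (.inl ⟨v, hv, by simp⟩)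
    · by_cases hwv : w = v
      · subst hwv; exact .inl ho.symm
      · exact .inr (.inl ⟨w, hw, by simpa [Function.update_apply, hwv] using ho⟩)
    · refine .inr (.inr fun w hw hew => (hN' w hw hew).trans ?_)
      rw [Function.update_apply]; split_ifs with hh
      · subst hh; omega
      · rfl

/-- The total distance of the prices from their maximum drops with every bid. -/
theorem sum_bid {v : ℕ} (hv : v < n) (hN : p v < N) :
    ∑ w ∈ Finset.range n, (N - Function.update p v (p v + 1) w) + 1 =
      ∑ w ∈ Finset.range n, (N - p w) := by
  rw [← Finset.add_sum_erase _ _ (Finset.mem_range.2 hv),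
    ← Finset.add_sum_erase _ (fun w => N - p w) (Finset.mem_range.2 hv)]
  rw [Finset.sum_congr rfl (g := fun w => N - p w)]
  · simp only [Function.update_self]; omega
  · intro w hw
    rw [Function.update_of_ne (Finset.ne_of_mem_erase hw)]

/-- The endpoint in the cover of the matching edge at `v`, for the threshold `k`. -/
def pick (p o : ℕ → ℕ) (k v : ℕ) : ℕ := if k < p v then v else o v - 1

/-- If `p w > k`, then `w` is owned and picked. Otherwise `p w < k ≤ N`, so `u` has not given up and
owns some `v` with `p v ≤ p w + 1 ≤ k`; as `k` is not a price, `p v < k` and the owner `u` is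
picked. -/
theorem pick_covers (h : Auction e n N 0 0 p o) {k : ℕ} (hk : k ≤ N)
    (hgap : ∀ v < n, p v ≠ k) {u w : ℕ} (hu : u < n) (hw : w < n) (he : e u w) :
    ∃ v < n, o v ≠ 0 ∧ (pick p o k v = u ∨ pick p o k v = w) := by
  by_cases hkw : k < p w
  · exact ⟨w, hw, h.pos w hw (by omega), .inr (by simp [pick, hkw])⟩
  · have := hgap w hw
    rcases h.served u (by omega) hu with h0 | ⟨v, hv, ho⟩ | hN
    · omega
    · refine ⟨v, hv, by omega, .inl ?_⟩
      have := h.slack v hv u w hw ho he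
      have := hgap v hv
      rw [pick, if_neg (by omega), ho]; rfl
    · have := hN w hw he; omega

/-- The auction yields a minimum vertex cover: it has as many elements as there are edges in a
matching. -/
theorem card_le (h : Auction e n N 0 0 p o) (hbip : ∀ u v w, e u v → ¬ e v w) (k : ℕ)
    (F W : Finset ℕ) (hFW : F ⊆ W) (hF : ∀ u v, e u v → u ∉ F ∧ v ∉ F)
    (hW : ∀ u < n, ∀ v < n, e u v → u ∈ W ∨ v ∈ W) :
    (F ∪ ((Finset.range n).filter (o · ≠ 0)).image (pick p o k)).card ≤ W.card := by
  classical
  set M := (Finset.range n).filter (o · ≠ 0) with hM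
  have hMm : ∀ v ∈ M, v < n ∧ o v - 1 < n ∧ o v = o v - 1 + 1 ∧ e (o v - 1) v := by
    intro v hv
    simp only [hM, Finset.mem_filter, Finset.mem_range] at hv
    have := h.own v hv.1 (o v - 1) (by omega)
    exact ⟨hv.1, this.2.1, by omega, this.2.2⟩
  -- An endpoint in `W` of each matching edge. Distinct edges have distinct such endpoints: heads
  -- and tails never coincide by `hbip`, and no bidder owns two items.
  let g : ℕ → ℕ := fun v => if v ∈ W then v else o v - 1
  have hgW : M.image g ⊆ W := by
    intro x hx
    obtain ⟨v, hv, rfl⟩ := Finset.mem_image.1 hx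
    obtain ⟨h1, h2, -, h3⟩ := hMm v hv
    by_cases hvW : v ∈ W
    · simp [g, hvW]
    · simpa [g, hvW] using (hW _ h2 _ h1 h3).resolve_right hvW
  have hinj : Set.InjOn g M := by
    intro v hv w hw hvw
    obtain ⟨h1, h2, h3, h4⟩ := hMm v hv
    obtain ⟨h1', h2', h3', h4'⟩ := hMm w hw
    simp only [g] at hvw
    split_ifs at hvw
    · exact hvw
    · exact absurd h4' (hvw ▸ hbip _ _ _ h4)
    · exact absurd h4 (hvw ▸ hbip _ _ _ h4')
    · exact h.inj v h1 w h1' (by omega) (by omega)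
  have hdisj : Disjoint F (M.image g) := by
    rw [Finset.disjoint_right]
    intro x hx
    obtain ⟨v, hv, rfl⟩ := Finset.mem_image.1 hx
    have := hF _ _ (hMm v hv).2.2.2
    simp only [g]
    split_ifs
    · exact this.2
    · exact this.1
  calc (F ∪ M.image (pick p o k)).card ≤ F.card + (M.image (pick p o k)).card :=
        Finset.card_union_le _ _
    _ ≤ F.card + M.card := Nat.add_le_add_left Finset.card_image_le _
    _ = (F ∪ M.image g).card := by
        rw [Finset.card_union_of_disjoint hdisj, Finset.card_image_of_injOn hinj]
    _ ≤ W.card := Finset.card_le_card (Finset.union_subset hFW hgW)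

/-- Some price between `1` and `n + 1` is not taken. -/
theorem exists_gap (n : ℕ) (p : ℕ → ℕ) : ∃ k, 0 < k ∧ k ≤ n + 1 ∧ ∀ v < n, p v ≠ k := by
  by_contra! hcon
  -- Pigeonhole: `n` prices cannot fill `n + 1` values.
  have hsub : Finset.Icc 1 (n + 1) ⊆ (Finset.range n).image p := by
    intro k hk
    rw [Finset.mem_Icc] at hk
    obtain ⟨v, hv, rfl⟩ := hcon k hk.1 hk.2
    exact Finset.mem_image_of_mem _ (Finset.mem_range.2 hv)
  have := (Finset.card_le_card hsub).trans (Finset.card_image_le (f := p) (s := Finset.range n))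
  simp at this

end Auction

/-! ### Memory layout and the basic subroutines -/

namespace RAM

/-- The layout of the registers and the memory: an adjacency matrix `a` on `n` vertices behind
three cells, followed by the arrays `p`, `o` and `x`. -/
structure Layout (n s t : ℕ) (a : ℕ → ℕ → ℕ) (p o x : ℕ → ℕ) (σ : State) : Prop where
  reg0 : σ.reg 0 = 3 + n * n
  reg1 : σ.reg 1 = 1
  reg2 : σ.reg 2 = n
  reg3 : σ.reg 3 = s
  reg4 : σ.reg 4 = t
  reg5 : σ.reg 5 = 3 + n * n + n
  reg6 : σ.reg 6 = 3 + n * n + n + n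
  reg7 : σ.reg 7 = n + 1
  reg9 : σ.reg 9 = 0
  adj : ∀ u < n, ∀ v < n, σ.mem (3 + n * u + v) = a u v
  memp : ∀ v < n, σ.mem (3 + n * n + v) = p v
  memo : ∀ v < n, σ.mem (3 + n * n + n + v) = o v
  memx : ∀ v < n, σ.mem (3 + n * n + n + n + v) = x v

theorem adj_address_lt {n u v : ℕ} (hu : u < n) (hv : v < n) : 3 + n * u + v < 3 + n * n := by
  have : n * (u + 1) ≤ n * n := Nat.mul_le_mul_left n hu
  rw [Nat.mul_succ] at this
  omega

namespace Layout

variable {n s t : ℕ} {a : ℕ → ℕ → ℕ} {p o x : ℕ → ℕ} {σ τ : State}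

/-- The constants and base addresses occupy registers below 10. The subroutines work in higher
blocks, the inner ones from 50, 40 and 30 on, so that a caller's registers survive a call. Register
9 holds 0, which turns an addition into a copy. -/
theorem frame (h : Layout n s t a p o x σ) (hf : Frame 10 σ τ) (hm : τ.mem = σ.mem) :
    Layout n s t a p o x τ where
  reg0 := (hf 0 (by omega)).trans h.reg0
  reg1 := (hf 1 (by omega)).trans h.reg1
  reg2 := (hf 2 (by omega)).trans h.reg2
  reg3 := (hf 3 (by omega)).trans h.reg3
  reg4 := (hf 4 (by omega)).trans h.reg4
  reg5 := (hf 5 (by omega)).trans h.reg5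
  reg6 := (hf 6 (by omega)).trans h.reg6
  reg7 := (hf 7 (by omega)).trans h.reg7
  reg9 := (hf 9 (by omega)).trans h.reg9
  adj := by rw [hm]; exact h.adj
  memp := by rw [hm]; exact h.memp
  memo := by rw [hm]; exact h.memo
  memx := by rw [hm]; exact h.memx

theorem set (h : Layout n s t a p o x σ) {i y : ℕ} (hi : 10 ≤ i) :
    Layout n s t a p o x (σ.set i y) :=
  h.frame ((Frame.refl _ _).set hi) rfl

theorem putp (h : Layout n s t a p o x σ) {v y : ℕ} (hv : v < n) :
    Layout n s t a (Function.update p v y) o x (σ.put (3 + n * n + v) y) where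
  __ := h
  adj u hu w hw := by
    have := adj_address_lt hu hw
    rw [State.put_mem, Function.update_of_ne (by omega), h.adj u hu w hw]
  memp w hw := by
    have := h.memp w hw
    simp only [State.put_mem, Function.update_apply]
    split_ifs <;> omega
  memo w hw := by
    rw [State.put_mem, Function.update_of_ne (by omega), h.memo w hw]
  memx w hw := by
    rw [State.put_mem, Function.update_of_ne (by omega), h.memx w hw]

theorem puto (h : Layout n s t a p o x σ) {v y : ℕ} (hv : v < n) :
    Layout n s t a p (Function.update o v y) x (σ.put (3 + n * n + n + v) y) where
  __ := h
  adj u hu w hw := by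
    have := adj_address_lt hu hw
    rw [State.put_mem, Function.update_of_ne (by omega), h.adj u hu w hw]
  memo w hw := by
    have := h.memo w hw
    simp only [State.put_mem, Function.update_apply]
    split_ifs <;> omega
  memp w hw := by
    rw [State.put_mem, Function.update_of_ne (by omega), h.memp w hw]
  memx w hw := by
    rw [State.put_mem, Function.update_of_ne (by omega), h.memx w hw]

theorem putx (h : Layout n s t a p o x σ) {v y : ℕ} (hv : v < n) :
    Layout n s t a p o (Function.update x v y) (σ.put (3 + n * n + n + n + v) y) where
  __ := h
  adj u hu w hw := by
    have := adj_address_lt hu hw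
    rw [State.put_mem, Function.update_of_ne (by omega), h.adj u hu w hw]
  memx w hw := by
    have := h.memx w hw
    simp only [State.put_mem, Function.update_apply]
    split_ifs <;> omega
  memp w hw := by
    rw [State.put_mem, Function.update_of_ne (by omega), h.memp w hw]
  memo w hw := by
    rw [State.put_mem, Function.update_of_ne (by omega), h.memo w hw]

end Layout

variable {n s t : ℕ} {a : ℕ → ℕ → ℕ} {p o x : ℕ → ℕ}

/-- Read the entry of the adjacency matrix in row `reg i` and column `reg j` into register 50. -/
def adjProg (i j : ℕ) : Program :=
  block [.const 51 3, .add 51 51 j, .const 52 0, .add 52 52 i,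
    .whileNonzero 52 (block [.add 51 51 2, .sub 52 52 1]), .load 50 51]

theorem runs_adjProg {σ : State} (h : Layout n s t a p o x σ) {i j : ℕ} (hi : i < 50) (hj : j < 50)
    (hin : σ.reg i < n) (hjn : σ.reg j < n) :
    Runs (adjProg i j) σ (4 * n + 10) (fun τ => Frame 50 σ τ ∧ τ.mem = σ.mem ∧
      τ.reg 50 = a (σ.reg i) (σ.reg j)) := by
  apply Runs.of_le
  · apply Runs.const
    apply Runs.add
    apply Runs.const
    apply Runs.add
    apply Runs.cons
    -- The product `n * u` in the address is formed by repeated addition; `m` counts the additions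
    -- still to be made.
    · apply Runs.loop (fun m τ => Frame 50 σ τ ∧ τ.mem = σ.mem ∧ τ.reg 52 = m ∧
        τ.reg 51 + n * m = 3 + n * σ.reg i + σ.reg j) (b := 1 + (1 + 1)) (m := σ.reg i)
      · rintro m τ ⟨hf, hm, h52, h51⟩ hne
        obtain ⟨m, rfl⟩ : ∃ m', m = m' + 1 := ⟨m - 1, by omega⟩
        refine ⟨m, rfl, ?_⟩
        apply Runs.add
        apply Runs.sub
        apply Runs.nil
        refine ⟨(hf.set (by omega)).set (by omega), hm, ?_, ?_⟩
        · simp [h52, hf 1 (by omega), h.reg1]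
        · simp [hf 2 (by omega), h.reg2]
          rw [← h51]; ring
      · refine ⟨((((Frame.refl _ _).set ?_).set ?_).set ?_).set ?_, rfl, ?_, ?_⟩ <;> try omega
        · simp [show i ≠ 52 by omega, show i ≠ 51 by omega]
        · simp [show j ≠ 51 by omega]; omega
    · rintro τ ⟨⟨m, hf, hm, h52, h51⟩, h0⟩
      apply Runs.load
      apply Runs.nil
      refine ⟨hf.set le_rfl, hm, ?_⟩
      obtain rfl : m = 0 := by omega
      rw [Nat.mul_zero, Nat.add_zero] at h51
      simp [h51, hm, h.adj _ hin _ hjn]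
  · omega

/-- The edges between the out-neighbours of `s` and the in-neighbours of `t`, without the vertices
that are both. -/
def edge (a : ℕ → ℕ → ℕ) (s t u v : ℕ) : Prop :=
  a s u = 1 ∧ a u t = 0 ∧ a u v = 1 ∧ a v t = 1 ∧ a s v = 0

/-- Decide in register 40 whether `edge` holds between `reg u` and `reg v`. -/
def edgeProg (u v : ℕ) : Program :=
  block [adjProg 3 u, .add 41 50 9, adjProg u 4, .sub 41 41 50, adjProg v 4, .add 42 50 9,
    adjProg 3 v, .sub 42 42 50, adjProg u v, .add 40 41 42, .add 40 40 50, .sub 40 40 1,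
    .sub 40 40 1]

theorem runs_edgeProg {σ : State} (h : Layout n s t a p o x σ) (hs : s < n) (ht : t < n)
    (ha : ∀ u v, a u v ≤ 1) {u v : ℕ} (hu : u < 40)
    (hv : v < 40) (hun : σ.reg u < n) (hvn : σ.reg v < n) :
    Runs (edgeProg u v) σ (20 * n + 70) (fun τ => Frame 40 σ τ ∧ τ.mem = σ.mem ∧
      (τ.reg 40 ≠ 0 ↔ edge a s t (σ.reg u) (σ.reg v))) := by
  apply Runs.of_le
  · apply Runs.cons
    · exact runs_adjProg h (by omega) (by omega) (by rwa [h.reg3]) hun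
    rintro τ₁ ⟨hf₁, hm₁, hr₁⟩
    have h₁ := h.frame (hf₁.mono (by omega)) hm₁
    apply Runs.add
    apply Runs.cons
    · apply runs_adjProg (h₁.set (by omega)) (by omega) (by omega)
      · simp [hf₁ u (by omega), show u ≠ 41 by omega, hun]
      · simp [h₁.reg4, ht]
    rintro τ₂ ⟨hf₂, hm₂, hr₂⟩
    have h₂ := (h₁.set (by omega)).frame (hf₂.mono (by omega)) hm₂
    have e₂ : Frame 40 σ τ₂ := ((hf₁.mono (by omega)).set (by omega)).trans hf₂ (by omega)
    apply Runs.sub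
    apply Runs.cons
    · apply runs_adjProg (h₂.set (by omega)) (by omega) (by omega)
      · simp [e₂ v (by omega), show v ≠ 41 by omega, hvn]
      · simp [h₂.reg4, ht]
    rintro τ₃ ⟨hf₃, hm₃, hr₃⟩
    have h₃ := (h₂.set (by omega)).frame (hf₃.mono (by omega)) hm₃
    have e₃ : Frame 40 σ τ₃ := (e₂.set (by omega)).trans hf₃ (by omega)
    apply Runs.add
    apply Runs.cons
    · apply runs_adjProg (h₃.set (by omega)) (by omega) (by omega)
      · simp [h₃.reg3, hs]
      · simp [e₃ v (by omega), show v ≠ 42 by omega, hvn]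
    rintro τ₄ ⟨hf₄, hm₄, hr₄⟩
    have h₄ := (h₃.set (by omega)).frame (hf₄.mono (by omega)) hm₄
    have e₄ : Frame 40 σ τ₄ := (e₃.set (by omega)).trans hf₄ (by omega)
    apply Runs.sub
    apply Runs.cons
    · apply runs_adjProg (h₄.set (by omega)) (by omega) (by omega)
      · simp [e₄ u (by omega), show u ≠ 42 by omega, hun]
      · simp [e₄ v (by omega), show v ≠ 42 by omega, hvn]
    rintro τ₅ ⟨hf₅, hm₅, hr₅⟩
    have h₅ := (h₄.set (by omega)).frame (hf₅.mono (by omega)) hm₅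
    have e₅ : Frame 40 σ τ₅ := (e₄.set (by omega)).trans hf₅ (by omega)
    apply Runs.add
    apply Runs.add
    apply Runs.sub
    apply Runs.sub
    apply Runs.nil
    refine ⟨(((e₅.set ?_).set ?_).set ?_).set ?_, ?_, ?_⟩ <;> try omega
    · simp [hm₅, hm₄, hm₃, hm₂, hm₁]
    · simp [e₄ u (by omega), e₄ v (by omega), show u ≠ 42 by omega, show v ≠ 42 by omega] at hr₅
      simp [h₃.reg3, e₃ v (by omega), show v ≠ 42 by omega] at hr₄
      simp [h₂.reg4, e₂ v (by omega), show v ≠ 41 by omega] at hr₃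
      simp [h₁.reg4, hf₁ u (by omega), show u ≠ 41 by omega] at hr₂
      simp [h.reg3] at hr₁
      simp [h₅.reg1, hr₅, hf₅ 41 (by omega), hf₅ 42 (by omega), hf₄ 41 (by omega),
        hf₄ 42 (by omega), hr₄, hf₃ 41 (by omega), hr₃, hf₂ 41 (by omega), hr₂, hr₁, h₁.reg9,
        h₃.reg9, edge]
      -- For entries at most 1, the sum `(a s u - a u t) + (a v t - a s v) + a u v` exceeds 2
      -- exactly when all three terms are 1, which is `edge`.
      have := ha s (σ.reg u)
      have := ha (σ.reg u) t
      have := ha (σ.reg u) (σ.reg v)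
      have := ha (σ.reg v) t
      have := ha s (σ.reg v)
      omega
  · omega

/-- Find the least price, if below `n + 1`, of a neighbour of `reg 21`, and such a neighbour. -/
def minProg : Program :=
  block [.add 30 7 9, countdown 32 2 (block [edgeProg 21 32, .ifNonzero 40
    (block [.add 33 0 32, .load 33 33, .sub 34 30 33,
      .ifNonzero 34 (block [.add 30 33 9, .add 31 32 9]) (block [])]) (block [])])]

theorem runs_minProg {σ : State} (h : Layout n s t a p o x σ) (hs : s < n) (ht : t < n)
    (ha : ∀ u v, a u v ≤ 1) (hun : σ.reg 21 < n) :
    Runs minProg σ (100 * (n + 1) ^ 2) (fun τ => Frame 30 σ τ ∧ τ.mem = σ.mem ∧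
      τ.reg 30 ≤ n + 1 ∧
      (∀ w < n, edge a s t (σ.reg 21) w → τ.reg 30 ≤ p w) ∧
      (τ.reg 30 < n + 1 → τ.reg 31 < n ∧ edge a s t (σ.reg 21) (τ.reg 31) ∧
        p (τ.reg 31) = τ.reg 30)) := by
  apply Runs.of_le
  · apply Runs.add
    apply Runs.cons
    · apply Runs.countdown (b := 20 * n + 85) (fun m τ => Frame 30 σ τ ∧ τ.mem = σ.mem ∧
        τ.reg 30 ≤ n + 1 ∧
        (∀ w < n, m ≤ w → edge a s t (σ.reg 21) w → τ.reg 30 ≤ p w) ∧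
        (τ.reg 30 < n + 1 → τ.reg 31 < n ∧ edge a s t (σ.reg 21) (τ.reg 31) ∧
          p (τ.reg 31) = τ.reg 30))
      · rintro m τ ⟨hf, -⟩
        rw [hf 1 (by omega), h.reg1]
      · omega
      · refine ⟨((Frame.refl _ _).set ?_).set ?_, rfl, ?_, ?_, ?_⟩ <;> try omega
        · simp [h.reg7, h.reg9]
        · simp [h.reg2]; omega
        · simp [h.reg7, h.reg9]
      · rintro m τ hmn ⟨hf, hm, hle, hmin, hidx⟩ h32
        simp [h.reg2] at hmn
        have hτ := h.frame (hf.mono (by omega)) hm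
        apply Runs.of_le
        · apply Runs.cons
          · apply runs_edgeProg (hτ.set (by omega)) hs ht ha (by omega) (by omega)
            · simp [hf 21 (by omega), hun]
            · simp [hmn]
          rintro τ₁ ⟨hf₁, hm₁, he₁⟩
          have h₁ := (hτ.set (by omega)).frame (hf₁.mono (by omega)) hm₁
          have e₁ : Frame 30 σ τ₁ := (hf.set (by omega)).trans hf₁ (by omega)
          have e30 : τ₁.reg 30 = τ.reg 30 := by simp [hf₁ 30 (by omega)]
          have e31 : τ₁.reg 31 = τ.reg 31 := by simp [hf₁ 31 (by omega)]
          have e32 : τ₁.reg 32 = m := by simp [hf₁ 32 (by omega)]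
          have em : τ₁.mem = σ.mem := by rw [hm₁]; exact hm
          simp [hf 21 (by omega)] at he₁
          -- Shared by the three outcomes: a new minimum, an edge that is not cheaper, no edge.
          have hstep : ∀ y, (edge a s t (σ.reg 21) m → y ≤ p m) → y ≤ τ.reg 30 →
              ∀ w < n, m ≤ w → edge a s t (σ.reg 21) w → y ≤ p w := by
            intro y hy hy' w hw hmw hew
            rcases hmw.eq_or_lt with rfl | hmw
            · exact hy hew
            · exact hy'.trans (hmin w hw hmw hew)
          apply Runs.last
          · apply Runs.ite
            · intro hne
              have hed := he₁.1 hne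
              apply Runs.add
              apply Runs.load
              apply Runs.sub
              apply Runs.last
              · apply Runs.ite
                · intro hlt
                  simp [h₁.reg0, e32, h₁.memp m hmn, e30] at hlt
                  apply Runs.add
                  apply Runs.add
                  apply Runs.nil
                  simp [h₁.reg0, h₁.reg9, e32, h₁.memp m hmn]
                  refine ⟨?_, em, by omega, hstep _ (fun _ => le_rfl) (by omega), fun _ => ⟨hmn, hed⟩⟩
                  repeat' first | exact e₁ | apply Frame.set | omega
                · intro hge
                  simp [h₁.reg0, e32, h₁.memp m hmn, e30] at hge
                  apply Runs.nil
                  simp [e30, e31, e32]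
                  refine ⟨?_, em, by omega, hstep _ (fun _ => by omega) le_rfl,
                    fun hlt => hidx (by omega)⟩
                  repeat' first | exact e₁ | apply Frame.set | omega
            · intro h0
              apply Runs.nil
              rw [e30, e31]
              exact ⟨e32, e₁, em, hle, hstep _ (fun hed => absurd h0 (he₁.2 hed)) le_rfl, hidx⟩
        · omega
    · rintro τ ⟨hf, hm, hle, hmin, hidx⟩
      apply Runs.nil
      exact ⟨hf, hm, hle, fun w hw => hmin w hw (by omega), hidx⟩
  · simp [h.reg2]; ring_nf; omega

end RAM

namespace RAM
variable {n s t : ℕ} {a : ℕ → ℕ → ℕ} {p o x : ℕ → ℕ}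

/-! ### Running the auction and finding a price gap -/

/-- Let the bidder `reg 20 - 1` bid, then the owner that loses the item, and so on. -/
def bidProg : Program :=
  .whileNonzero 20 (block [.sub 21 20 1, minProg, .sub 25 7 30, .ifNonzero 25
    (block [.add 26 5 31, .load 27 26, .store 26 20, .add 20 27 9, .add 26 0 31, .add 30 30 1,
      .store 26 30])
    (block [.const 20 0])])

theorem runs_bidProg {σ : State} (h : Layout n s t a p o x σ) (hs : s < n) (ht : t < n)
    (ha : ∀ u v, a u v ≤ 1) {c : ℕ} (hA : Auction (edge a s t) n (n + 1) c (σ.reg 20) p o) :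
    Runs bidProg σ (120 * (n + 1) ^ 4) (fun τ => Frame 20 σ τ ∧
      ∃ p' o', Layout n s t a p' o' x τ ∧ Auction (edge a s t) n (n + 1) c 0 p' o') := by
  apply Runs.mono
  -- The measure is the total room left below the price cap, plus one while somebody is bidding. A
  -- bid lowers the first part; giving up lowers the second.
  · apply Runs.loop (b := 100 * (n + 1) ^ 2 + 14) (m := n * (n + 1) + 1)
      (fun m τ => Frame 20 σ τ ∧ ∃ p' o', Layout n s t a p' o' x τ ∧
        Auction (edge a s t) n (n + 1) c (τ.reg 20) p' o' ∧
        ∑ v ∈ Finset.range n, (n + 1 - p' v) + (if τ.reg 20 = 0 then 0 else 1) ≤ m)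
    · rintro m τ ⟨hf, p', o', hL, hA', hm⟩ hne
      rw [if_neg hne] at hm
      obtain ⟨m, rfl⟩ : ∃ m', m = m' + 1 := ⟨m - 1, by omega⟩
      refine ⟨m, rfl, ?_⟩
      have hcur := hA'.cur_mem hne
      apply Runs.of_le
      · apply Runs.sub
        apply Runs.cons
        · apply runs_minProg (hL.set (by omega)) hs ht ha
          simp [hL.reg1]; omega
        rintro τ₁ ⟨hf₁, hm₁, hle, hmin, hidx⟩
        have h₁ := (hL.set (by omega)).frame (hf₁.mono (by omega)) hm₁
        have e₁ : Frame 20 σ τ₁ := (hf.set (by omega)).trans hf₁ (by omega)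
        have e20 : τ₁.reg 20 = τ.reg 20 := by simp [hf₁ 20 (by omega)]
        simp only [State.set_reg, if_true, hL.reg1] at hmin hidx
        apply Runs.sub
        apply Runs.last
        apply Runs.ite
        · intro hlt
          simp [h₁.reg7] at hlt
          obtain ⟨hv, he, hp⟩ := hidx (by omega)
          apply Runs.add
          apply Runs.load
          apply Runs.store
          apply Runs.add
          apply Runs.add
          apply Runs.add
          apply Runs.store
          apply Runs.nil
          simp [h₁.reg5, h₁.reg9, h₁.reg0, h₁.reg1, h₁.memo _ hv, e20]
          refine ⟨?_, _, _, ?_, hA'.bid hne hv he (by omega) ?_, ?_⟩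
          · repeat' first | exact e₁ | apply Frame.put | apply Frame.set | omega
          · rw [hp]
            apply Layout.putp _ hv
            repeat' apply Layout.set _ (by omega)
            apply Layout.puto _ hv
            repeat' apply Layout.set _ (by omega)
            exact h₁
          · rw [hp]; exact hmin
          · have := Auction.sum_bid (N := n + 1) hv (p := p') (by omega)
            split_ifs <;> omega
        · intro hge
          simp [h₁.reg7] at hge
          apply Runs.const
          apply Runs.nil
          simp
          refine ⟨?_, _, _, ?_, hA'.drop ?_, by omega⟩
          · repeat' first | exact e₁ | apply Frame.set | omega
          · repeat' apply Layout.set _ (by omega)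
            exact h₁
          · intro w hw hew
            have := hmin w hw hew
            omega
      · omega
    · refine ⟨Frame.refl _ _, p, o, h, hA, ?_⟩
      have : ∑ v ∈ Finset.range n, (n + 1 - p v) ≤ n * (n + 1) := by
        refine (Finset.sum_le_sum (g := fun _ => n + 1) fun v _ => Nat.sub_le _ _).trans ?_
        simp
      split_ifs <;> omega
  · ring_nf; omega
  · rintro τ ⟨⟨m, hf, p', o', hL, hA, -⟩, h0⟩
    rw [h0] at hA
    exact ⟨hf, p', o', hL, hA⟩

/-- Run the auction. -/
def auctionProg : Program := countdown 11 2 (block [.add 20 11 1, bidProg])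

theorem runs_auctionProg {σ : State} (h : Layout n s t a (fun _ => 0) (fun _ => 0) x σ)
    (hs : s < n) (ht : t < n) (ha : ∀ u v, a u v ≤ 1) :
    Runs auctionProg σ (130 * (n + 1) ^ 5) (fun τ =>
      ∃ p' o', Layout n s t a p' o' x τ ∧ Auction (edge a s t) n (n + 1) 0 0 p' o') := by
  apply Runs.mono
  · apply Runs.countdown (b := 120 * (n + 1) ^ 4 + 2) (fun m τ => ∃ p' o',
      Layout n s t a p' o' x τ ∧ Auction (edge a s t) n (n + 1) m 0 p' o')
    · rintro m τ ⟨p', o', hL, -⟩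
      exact hL.reg1
    · omega
    · refine ⟨_, _, h.set (by omega), ?_⟩
      rw [h.reg2]
      exact Auction.init
    · rintro m τ hm ⟨p', o', hL, hA⟩ h11
      rw [h.reg2] at hm
      apply Runs.of_le
      · apply Runs.add
        apply Runs.last
        apply (runs_bidProg ((hL.set (by omega)).set (by omega)) hs ht ha (c := m) ?_).mono le_rfl
        · rintro υ ⟨hf, hυ⟩
          refine ⟨?_, hυ⟩
          rw [hf 11 (by omega)]; simp
        · simpa [hL.reg1] using hA.enter hm
      · omega
  · rw [h.reg2]; ring_nf; omega
  · exact fun _ hτ => hτ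

/-- Find a number between `1` and `n + 1` that is not a price. -/
def gapProg : Program :=
  countdown 13 7 (block [.add 14 13 1, .const 15 0,
    countdown 16 2 (block [.add 17 0 16, .load 17 17, .sub 18 17 14, .sub 19 14 17, .add 18 18 19,
      .ifNonzero 18 (block []) (block [.const 15 1])]),
    .ifNonzero 15 (block []) (block [.add 12 14 9])])

theorem runs_gapProg {σ : State} (h : Layout n s t a p o x σ) :
    Runs gapProg σ (50 * (n + 1) ^ 2) (fun τ => Layout n s t a p o x τ ∧
      τ.reg 12 ≤ n + 1 ∧ ∀ v < n, p v ≠ τ.reg 12) := by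
  apply Runs.mono
  -- The invariant is conditional because register 12 is meaningless until a gap has been met;
  -- `Auction.exists_gap` removes the condition at the end.
  · apply Runs.countdown (b := 20 * n + 20) (fun m τ => Layout n s t a p o x τ ∧
      ((∃ k, m < k ∧ k ≤ n + 1 ∧ ∀ v < n, p v ≠ k) →
        τ.reg 12 ≤ n + 1 ∧ ∀ v < n, p v ≠ τ.reg 12))
    · rintro m τ ⟨hL, -⟩
      exact hL.reg1
    · omega
    · refine ⟨h.set (by omega), ?_⟩
      rintro ⟨k, hk, hk', -⟩
      rw [h.reg7] at hk
      omega
    · rintro m τ hm ⟨hL, hgap⟩ h13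
      rw [h.reg7] at hm
      apply Runs.of_le
      · apply Runs.add
        apply Runs.const
        simp [hL.reg1]
        have h₁ := ((hL.set (i := 13) (y := m) (by omega)).set (i := 14) (y := m + 1)
          (by omega)).set (i := 15) (y := 0) (by omega)
        set τ₁ := ((τ.set 13 m).set 14 (m + 1)).set 15 0 with hτ₁
        have e14 : τ₁.reg 14 = m + 1 := by simp [hτ₁]
        have e15 : τ₁.reg 15 = 0 := by simp [hτ₁]
        have e12 : τ₁.reg 12 = τ.reg 12 := by simp [hτ₁]
        have e13 : τ₁.reg 13 = m := by simp [hτ₁]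
        apply Runs.cons
        · apply Runs.countdown (b := 10) (fun i υ => Frame 15 τ₁ υ ∧ υ.mem = τ₁.mem ∧
            (υ.reg 15 ≠ 0 ↔ ∃ v < n, i ≤ v ∧ p v = m + 1))
          · rintro i υ ⟨hf, -⟩
            rw [hf 1 (by omega), h₁.reg1]
          · omega
          · refine ⟨(Frame.refl _ _).set (by omega), rfl, ?_⟩
            simp [e15, h₁.reg2]
            intros; omega
          · rintro i υ hi ⟨hf, hmem, hiff⟩ h16
            rw [h₁.reg2] at hi
            have h₂ := h₁.frame (hf.mono (by omega)) hmem
            have e14' : υ.reg 14 = m + 1 := by rw [hf 14 (by omega), e14]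
            have hstep : (∃ v < n, i ≤ v ∧ p v = m + 1) ↔ p i = m + 1 ∨ υ.reg 15 ≠ 0 := by
              rw [hiff]
              constructor
              · rintro ⟨v, hv, hiv, hp⟩
                rcases hiv.eq_or_lt with rfl | hiv
                · exact .inl hp
                · exact .inr ⟨v, hv, hiv, hp⟩
              · rintro (hp | ⟨v, hv, hiv, hp⟩)
                · exact ⟨i, hi, le_rfl, hp⟩
                · exact ⟨v, hv, by omega, hp⟩
            apply Runs.of_le
            · apply Runs.add
              apply Runs.load
              apply Runs.sub
              apply Runs.sub
              apply Runs.add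
              apply Runs.last
              apply Runs.ite
              · intro hne
                apply Runs.nil
                simp [h₂.reg0, h₂.memp i hi, e14'] at hne
                simp [hmem]
                refine ⟨?_, ?_⟩
                · repeat' first | exact hf | apply Frame.set | omega
                · have := hstep
                  grind
              · intro heq
                apply Runs.const
                apply Runs.nil
                simp [h₂.reg0, h₂.memp i hi, e14'] at heq
                simp [hmem]
                refine ⟨?_, ?_⟩
                · repeat' first | exact hf | apply Frame.set | omega
                · exact ⟨i, hi, le_rfl, by omega⟩
            · omega
        · rintro υ ⟨hf, hmem, hiff⟩
          have h₂ := h₁.frame (hf.mono (by omega)) hmem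
          apply Runs.last
          apply Runs.ite
          · intro hne
            apply Runs.nil
            obtain ⟨v, hv, -, hp⟩ := hiff.1 hne
            refine ⟨by rw [hf 13 (by omega), e13], h₂, ?_⟩
            intro k hk hk' hkp
            rw [hf 12 (by omega), e12]
            refine hgap ⟨k, ?_, hk', hkp⟩
            have : k ≠ m + 1 := fun hk => hkp v hv (hp.trans hk.symm)
            omega
          · intro h0
            apply Runs.add
            apply Runs.nil
            refine ⟨by simp [hf 13 (by omega), e13], h₂.set (by omega), ?_⟩
            intro _ _ _ _
            simp [hf 14 (by omega), e14, h₂.reg9]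
            refine ⟨by omega, fun v hv hp => hiff.2 ⟨v, hv, by omega, hp⟩ h0⟩
      · simp [hL.reg2]; omega
  · rw [h.reg7]; ring_nf; omega
  · rintro τ ⟨hL, hgap⟩
    exact ⟨hL, hgap (Auction.exists_gap n p)⟩

/-! ### Marking the forced vertices and the cover -/

/-- Below `n`, the array `x` is the characteristic vector of `S`. -/
def Indicates (n : ℕ) (x : ℕ → ℕ) (S : ℕ → Prop) : Prop := ∀ w < n, x w ≤ 1 ∧ (x w = 1 ↔ S w)

theorem Indicates.update {S S' : ℕ → Prop} (h : Indicates n x S) {z : ℕ}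
    (hS : ∀ w, S' w ↔ w = z ∨ S w) : Indicates n (Function.update x z 1) S' := by
  intro w hw
  have := h w hw
  rw [Function.update_apply, hS]
  split_ifs with hwz
  · simp [hwz]
  · simpa [hwz] using this

theorem Indicates.congr {S S' : ℕ → Prop} (h : Indicates n x S) (hS : ∀ w, S' w ↔ S w) :
    Indicates n x S' := by
  intro w hw
  rw [hS]; exact h w hw

/-- Mark the out-neighbours of `s` that are in-neighbours of `t`. -/
def commonProg : Program :=
  countdown 20 2 (block [adjProg 3 20, .add 21 50 9, adjProg 20 4, .add 21 21 50, .sub 21 21 1,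
    .ifNonzero 21 (block [.add 22 6 20, .store 22 1]) (block [])])

theorem runs_commonProg {σ : State} (h : Layout n s t a p o (fun _ => 0) σ) (hs : s < n) (ht : t < n)
    (ha : ∀ u v, a u v ≤ 1) :
    Runs commonProg σ (50 * (n + 1) ^ 2) (fun τ => ∃ x, Layout n s t a p o x τ ∧
      Indicates n x (fun v => a s v = 1 ∧ a v t = 1)) := by
  apply Runs.mono
  · apply Runs.countdown (b := 8 * n + 40) (fun m τ => ∃ x, Layout n s t a p o x τ ∧
      Indicates n x (fun v => m ≤ v ∧ a s v = 1 ∧ a v t = 1))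
    · rintro m τ ⟨x, hL, -⟩
      exact hL.reg1
    · omega
    · refine ⟨_, h.set (by omega), ?_⟩
      intro w hw
      rw [h.reg2]
      simp; omega
    · rintro m τ hm ⟨x, hL, hx⟩ h20
      rw [h.reg2] at hm
      apply Runs.of_le
      · apply Runs.cons
        · apply runs_adjProg (hL.set (by omega)) (by omega) (by omega)
          · simp [hL.reg3, hs]
          · simp [hm]
        rintro τ₁ ⟨hf₁, hm₁, hr₁⟩
        have h₁ := (hL.set (by omega)).frame (hf₁.mono (by omega)) hm₁
        have e20 : τ₁.reg 20 = m := by simp [hf₁ 20 (by omega)]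
        simp [hL.reg3] at hr₁
        apply Runs.add
        apply Runs.cons
        · apply runs_adjProg (h₁.set (by omega)) (by omega) (by omega)
          · simp [e20, hm]
          · simp [h₁.reg4, ht]
        rintro τ₂ ⟨hf₂, hm₂, hr₂⟩
        have h₂ := (h₁.set (by omega)).frame (hf₂.mono (by omega)) hm₂
        have e20' : τ₂.reg 20 = m := by simp [hf₂ 20 (by omega), e20]
        have e21 : τ₂.reg 21 = a s m := by simp [hf₂ 21 (by omega), hr₁, h₁.reg9]
        simp [h₁.reg4, e20] at hr₂
        have := ha s m
        have := ha m t
        have hiff : ∀ w, m ≤ w ↔ w = m ∨ m + 1 ≤ w := by intro w; omega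
        apply Runs.add
        apply Runs.sub
        apply Runs.last
        apply Runs.ite
        · intro hne
          simp [e21, hr₂, h₂.reg1] at hne
          apply Runs.add
          apply Runs.store
          apply Runs.nil
          simp [h₂.reg6, h₂.reg1, e20']
          refine ⟨_, ?_, hx.update (z := m) ?_⟩
          · apply Layout.putx _ hm
            repeat' apply Layout.set _ (by omega)
            exact h₂
          · intro w
            rw [hiff]
            constructor
            · tauto
            · rintro (rfl | hw)
              · exact ⟨.inl rfl, by omega, by omega⟩
              · exact ⟨.inr hw.1, hw.2⟩
        · intro h0
          simp [e21, hr₂, h₂.reg1] at h0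
          apply Runs.nil
          simp [e20']
          refine ⟨x, ?_, hx.congr ?_⟩
          · repeat' apply Layout.set _ (by omega)
            exact h₂
          · intro w
            rw [hiff]
            constructor
            · rintro ⟨rfl | hw, h1, h2⟩
              · omega
              · exact ⟨hw, h1, h2⟩
            · rintro ⟨hw, h1, h2⟩
              exact ⟨.inr hw, h1, h2⟩
      · omega
  · rw [h.reg2]; ring_nf; omega
  · rintro τ ⟨x, hL, hx⟩
    exact ⟨x, hL, hx.congr (by simp)⟩

/-- Mark the endpoints of the matching edges that are in the cover for the threshold `reg 12`. -/
def coverProg : Program :=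
  countdown 20 2 (block [.add 21 5 20, .load 21 21, .ifNonzero 21
    (block [.add 22 0 20, .load 22 22, .sub 22 22 12, .ifNonzero 22
      (block [.add 23 6 20, .store 23 1])
      (block [.sub 21 21 1, .add 23 6 21, .store 23 1])])
    (block [])])

/-- Marks are only added, so the earlier set `S` stays in the result. The bound on owners keeps
every write inside the array `x`. -/
theorem runs_coverProg {σ : State} (h : Layout n s t a p o x σ) {S : ℕ → Prop}
    (hx : Indicates n x S) (ho : ∀ v < n, o v ≠ 0 → o v - 1 < n) :
    Runs coverProg σ (30 * (n + 1)) (fun τ => ∃ x, Layout n s t a p o x τ ∧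
      Indicates n x (fun w => S w ∨ ∃ v < n, o v ≠ 0 ∧ Auction.pick p o (σ.reg 12) v = w)) := by
  apply Runs.mono
  · apply Runs.countdown (b := 20) (fun m τ => ∃ x, Layout n s t a p o x τ ∧
      Frame 20 σ τ ∧ Indicates n x (fun w => S w ∨
        ∃ v < n, m ≤ v ∧ o v ≠ 0 ∧ Auction.pick p o (σ.reg 12) v = w))
    · rintro m τ ⟨x, hL, -⟩
      exact hL.reg1
    · omega
    · refine ⟨_, h.set (by omega), (Frame.refl _ _).set (by omega), hx.congr fun w => ?_⟩
      rw [h.reg2]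
      constructor
      · rintro (h | ⟨v, hv, hv', -⟩)
        · exact h
        · omega
      · exact .inl
    · rintro m τ hm ⟨x, hL, hf, hx⟩ h20
      rw [h.reg2] at hm
      have hput : ∀ w, o m ≠ 0 → ((S w ∨ ∃ v < n, m ≤ v ∧ o v ≠ 0 ∧
          Auction.pick p o (σ.reg 12) v = w) ↔ w = Auction.pick p o (σ.reg 12) m ∨ (S w ∨
          ∃ v < n, m + 1 ≤ v ∧ o v ≠ 0 ∧ Auction.pick p o (σ.reg 12) v = w)) := by
        intro w hne
        constructor
        · rintro (hS | ⟨v, hv, hmv, hov, hw⟩)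
          · exact .inr (.inl hS)
          · rcases hmv.eq_or_lt with rfl | hmv
            · exact .inl hw.symm
            · exact .inr (.inr ⟨v, hv, hmv, hov, hw⟩)
        · rintro (rfl | hS | ⟨v, hv, hmv, hov, hw⟩)
          · exact .inr ⟨m, hm, le_rfl, hne, rfl⟩
          · exact .inl hS
          · exact .inr ⟨v, hv, by omega, hov, hw⟩
      apply Runs.of_le
      · apply Runs.add
        apply Runs.load
        simp [hL.reg5, hL.memo m hm]
        have h₁ := ((hL.set (i := 20) (y := m) (by omega)).set (i := 21)
          (y := 3 + n * n + n + m) (by omega)).set (i := 21) (y := o m) (by omega)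
        have hf₁ : Frame 20 σ (((τ.set 20 m).set 21 (3 + n * n + n + m)).set 21 (o m)) :=
          ((hf.set (by omega)).set (by omega)).set (by omega)
        set τ₁ := ((τ.set 20 m).set 21 (3 + n * n + n + m)).set 21 (o m) with hτ₁
        have e20 : τ₁.reg 20 = m := by simp [hτ₁]
        have e21 : τ₁.reg 21 = o m := by simp [hτ₁]
        have e12 : τ₁.reg 12 = σ.reg 12 := hf₁ 12 (by omega)
        apply Runs.last
        apply Runs.ite
        · intro hne
          rw [e21] at hne
          apply Runs.add
          apply Runs.load
          apply Runs.sub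
          apply Runs.last
          apply Runs.ite
          · intro hlt
            simp [h₁.reg0, e20, h₁.memp m hm, e12] at hlt
            apply Runs.add
            apply Runs.store
            apply Runs.nil
            simp [h₁.reg6, h₁.reg1, e20]
            refine ⟨_, ?_, ?_, hx.update (z := m) fun w => ?_⟩
            · apply Layout.putx _ hm
              repeat' first | exact h₁ | apply Layout.set _ (by omega)
            · repeat' first | exact hf₁ | apply Frame.put | apply Frame.set | omega
            · rw [hput w hne, Auction.pick, if_pos (by omega)]
          · intro hge
            simp [h₁.reg0, e20, h₁.memp m hm, e12] at hge
            apply Runs.sub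
            apply Runs.add
            apply Runs.store
            apply Runs.nil
            simp [h₁.reg6, h₁.reg1, e20, e21]
            refine ⟨_, ?_, ?_, hx.update (z := o m - 1) fun w => ?_⟩
            · apply Layout.putx _ (ho m hm hne)
              repeat' first | exact h₁ | apply Layout.set _ (by omega)
            · repeat' first | exact hf₁ | apply Frame.put | apply Frame.set | omega
            · rw [hput w hne, Auction.pick, if_neg (by omega)]
        · intro h0
          rw [e21] at h0
          apply Runs.nil
          refine ⟨e20, x, h₁, hf₁, hx.congr fun w => ?_⟩
          constructor
          · rintro (hS | ⟨v, hv, hmv, hov, hw⟩)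
            · exact .inl hS
            · rcases hmv.eq_or_lt with rfl | hmv
              · exact absurd h0 hov
              · exact .inr ⟨v, hv, hmv, hov, hw⟩
          · rintro (hS | ⟨v, hv, hmv, hov, hw⟩)
            · exact .inl hS
            · exact .inr ⟨v, hv, by omega, hov, hw⟩
      · omega
  · rw [h.reg2]; omega
  · rintro τ ⟨x, hL, -, hx⟩
    exact ⟨x, hL, hx.congr (by simp)⟩

end RAM

/-! ### Minimum hitting sets for short walks -/

namespace RAM
variable {n s t : ℕ} {a : ℕ → ℕ → ℕ} {p o x : ℕ → ℕ}

/-- The set `W` meets all paths of length at most `T` from `s` to `t` in the graph with adjacency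
matrix `a`, where `T ≤ 3`. -/
structure Hits (T : ℝ) (n s t : ℕ) (a : ℕ → ℕ → ℕ) (W : Finset ℕ) : Prop where
  zero : 0 ≤ T → s ≠ t
  one : 1 ≤ T → a s t = 0
  two : 2 ≤ T → ∀ v < n, a s v = 1 → a v t = 1 → v ∈ W
  three : 3 ≤ T → ∀ u < n, ∀ v < n, a s u = 1 → a u v = 1 → a v t = 1 → u ∈ W ∨ v ∈ W

/-- A set of least cardinality among those that meet all short paths, avoiding `s` and `t`. -/
structure IsMinHitting (T : ℝ) (n s t : ℕ) (a : ℕ → ℕ → ℕ) (X : Finset ℕ) : Prop where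
  hits : Hits T n s t a X
  source : s ∉ X
  target : t ∉ X
  card_le : ∀ W, Hits T n s t a W → X.card ≤ W.card

theorem isMinHitting_empty {T : ℝ} (hT : T < 2) (h0 : 0 ≤ T → s ≠ t) (h1 : 1 ≤ T → a s t = 0) :
    IsMinHitting T n s t a ∅ where
  hits := ⟨h0, h1, fun h => by linarith, fun h => by linarith⟩
  source := by simp
  target := by simp
  card_le := by simp

theorem isMinHitting_common {T : ℝ} (hT : 2 ≤ T) (hT' : T < 3) (h0 : s ≠ t) (h1 : a s t = 0) :
    IsMinHitting T n s t a ((Finset.range n).filter fun v => a s v = 1 ∧ a v t = 1) where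
  hits := ⟨fun _ => h0, fun _ => h1, fun _ v hv h h' => by simp [hv, h, h'], fun h => by linarith⟩
  source := by simp [h1]
  target := by simp [h1]
  card_le W hW := by
    refine Finset.card_le_card fun v hv => ?_
    simp only [Finset.mem_filter, Finset.mem_range] at hv
    exact hW.two hT v hv.1 hv.2.1 hv.2.2

/-- The common neighbours are forced, and the walks with three edges that they miss are exactly the
edges of `edge`. Tails satisfy `a s u = 1` and heads `a s v = 0`, so no vertex is both, and neither
kind is a common neighbour; this is what `Auction.card_le` needs. -/
theorem isMinHitting_auction {T : ℝ} (hT : 3 ≤ T) (h0 : s ≠ t) (h1 : a s t = 0)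
    (ha : ∀ u v, a u v ≤ 1)
    (h : Auction (edge a s t) n (n + 1) 0 0 p o) {k : ℕ} (hk : k ≤ n + 1) (hgap : ∀ v < n, p v ≠ k) :
    IsMinHitting T n s t a (((Finset.range n).filter fun v => a s v = 1 ∧ a v t = 1) ∪
      ((Finset.range n).filter (o · ≠ 0)).image (Auction.pick p o k)) := by
  -- Neither endpoint of an edge of `edge` is `s` or `t`: each of the four coincidences contradicts
  -- `a s t = 0` or the two zero entries in `edge`.
  have hpick : ∀ v < n, o v ≠ 0 →
      Auction.pick p o k v ≠ s ∧ Auction.pick p o k v ≠ t := by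
    intro v hv hov
    obtain ⟨-, -, e1, e2, e3, e4, e5⟩ := h.own v hv (o v - 1) (by omega)
    rw [Auction.pick]
    split_ifs
    · constructor <;> rintro rfl <;> omega
    · constructor
      · intro he; rw [he] at e3; omega
      · intro he; rw [he] at e1; omega
  have htwo : ∀ W : Finset ℕ, Hits T n s t a W →
      (Finset.range n).filter (fun v => a s v = 1 ∧ a v t = 1) ⊆ W := by
    intro W hW v hv
    simp only [Finset.mem_filter, Finset.mem_range] at hv
    exact hW.two (by linarith) v hv.1 hv.2.1 hv.2.2
  refine ⟨⟨fun _ => h0, fun _ => h1, fun _ v hv h h' => ?_, fun _ u hu v hv hsu huv hvt => ?_⟩,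
    ?_, ?_, fun W hW => ?_⟩
  · simp [hv, h, h']
  · by_cases hut : a u t = 1
    · left; simp [hu, hsu, hut]
    by_cases hsv : a s v = 1
    · right; simp [hv, hsv, hvt]
    have := ha u t
    have := ha s v
    obtain ⟨w, hw, how, hp⟩ := h.pick_covers hk hgap hu hv
      ⟨hsu, by omega, huv, hvt, by omega⟩
    simp only [Finset.mem_union, Finset.mem_image]
    rcases hp with hp | hp
    · exact .inl (.inr ⟨w, by simp [hw, how], hp⟩)
    · exact .inr (.inr ⟨w, by simp [hw, how], hp⟩)
  · simp only [Finset.mem_union, Finset.mem_image, Finset.mem_filter, Finset.mem_range]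
    rintro (⟨-, -, h2⟩ | ⟨v, ⟨hv, hov⟩, hp⟩)
    · omega
    · exact (hpick v hv hov).1 hp
  · simp only [Finset.mem_union, Finset.mem_image, Finset.mem_filter, Finset.mem_range]
    rintro (⟨-, h2, -⟩ | ⟨v, ⟨hv, hov⟩, hp⟩)
    · omega
    · exact (hpick v hv hov).2 hp
  · refine h.card_le ?_ k _ W (htwo W hW) ?_ ?_
    · rintro u v w ⟨-, -, -, -, e5⟩ ⟨e1, -⟩
      omega
    · rintro u v ⟨e1, e2, e3, e4, e5⟩
      constructor <;> simp <;> omega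
    · rintro u hu v hv ⟨e1, e2, e3, e4, e5⟩
      exact hW.three hT u hu v hv e1 e3 e4

open Classical in
/-- Compute a minimum hitting set, given that there is one. -/
noncomputable def hitProg (T : ℝ) : Program :=
  if T < 2 then .skip else if T < 3 then commonProg else
    block [commonProg, auctionProg, gapProg, coverProg]

/-- The comparison of `T` with 2 and 3 selects the program and is not executed by the machine. For
`T < 2` nothing is done, since the array `x` is already the zero vector of the empty set. -/
theorem runs_hitProg {T : ℝ} {σ : State}
    (h : Layout n s t a (fun _ => 0) (fun _ => 0) (fun _ => 0) σ) (hs : s < n)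
    (ht : t < n) (ha : ∀ u v, a u v ≤ 1) (h0 : 0 ≤ T → s ≠ t) (h1 : 1 ≤ T → a s t = 0) :
    Runs (hitProg T) σ (300 * (n + 1) ^ 5) (fun τ => ∃ X p o x, IsMinHitting T n s t a X ∧
      Layout n s t a p o x τ ∧ Indicates n x (· ∈ X)) := by
  have hb : 50 * (n + 1) ^ 2 ≤ 50 * (n + 1) ^ 5 := by gcongr <;> omega
  have hb' : 30 * (n + 1) ^ 1 ≤ 30 * (n + 1) ^ 5 := by gcongr <;> omega
  have hb'' : 0 < (n + 1) ^ 5 := by positivity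
  rw [pow_one] at hb'
  unfold hitProg
  split_ifs with hT hT'
  · refine ⟨σ, 1, .skip σ, by omega, ∅, _, _, _, isMinHitting_empty hT h0 h1, h, ?_⟩
    intro w _; simp
  · rw [not_lt] at hT
    refine (runs_commonProg h hs ht ha).mono (by omega) ?_
    rintro τ ⟨x, hL, hx⟩
    refine ⟨_, _, _, _, isMinHitting_common hT hT' (h0 (by linarith)) (h1 (by linarith)), hL, ?_⟩
    intro w hw
    simpa [hw] using hx w hw
  · rw [not_lt] at hT'
    apply Runs.of_le
    · apply Runs.cons (runs_commonProg h hs ht ha)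
      rintro τ₁ ⟨x, hL₁, hx⟩
      apply Runs.cons (runs_auctionProg hL₁ hs ht ha)
      rintro τ₂ ⟨p, o, hL₂, hA⟩
      apply Runs.cons (runs_gapProg hL₂)
      rintro τ₃ ⟨hL₃, hk, hgap⟩
      apply Runs.last
      apply (runs_coverProg hL₃ hx ?_).mono le_rfl
      · rintro τ₄ ⟨x', hL₄, hx'⟩
        refine ⟨_, _, _, _, isMinHitting_auction hT' (h0 (by linarith)) (h1 (by linarith)) ha hA
          hk hgap, hL₄, ?_⟩
        intro w hw
        have := hx' w hw
        simpa [hw, and_assoc] using this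
      · intro v hv hov
        exact (hA.own v hv (o v - 1) (by omega)).2.1
    · omega

/-! ### Feasibility test, output and the complete program -/

open Classical in
/-- Decide in register 16 whether there is no hitting set. -/
noncomputable def failProg (T : ℝ) : Program :=
  if T < 0 then .const 16 0 else
    block [.sub 17 3 4, .sub 18 4 3, .add 17 17 18, .ifNonzero 17
      (if T < 1 then .const 16 0 else block [adjProg 3 4, .add 16 50 9]) (.const 16 1)]

theorem runs_failProg {T : ℝ} {σ : State} (h : Layout n s t a p o x σ) (hs : s < n) (ht : t < n) :
    Runs (failProg T) σ (20 * (n + 1)) (fun τ => Layout n s t a p o x τ ∧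
      (τ.reg 16 = 0 ↔ (0 ≤ T → s ≠ t) ∧ (1 ≤ T → a s t = 0))) := by
  have hconst : ∀ (τ : State) y, Runs (.const 16 y) τ 1 (fun υ => υ = τ.set 16 y) :=
    fun τ y => ⟨_, 1, .const τ 16 y, le_rfl, rfl⟩
  unfold failProg
  split_ifs with hT hT'
  · refine (hconst σ 0).mono (by omega) ?_
    rintro _ rfl
    refine ⟨h.set (by omega), ?_⟩
    simp only [State.set_reg, if_true, true_iff]
    exact ⟨fun _ => by linarith, fun _ => by linarith⟩
  · apply Runs.of_le
    · apply Runs.sub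
      apply Runs.sub
      apply Runs.add
      apply Runs.last
      apply Runs.ite
      · intro hne
        simp [h.reg3, h.reg4] at hne
        apply (hconst _ _).mono le_rfl
        rintro _ rfl
        refine ⟨?_, ?_⟩
        · repeat' first | exact h | apply Layout.set _ (by omega)
        · simp only [State.set_reg, if_true, true_iff]
          exact ⟨fun _ => by omega, fun _ => by linarith⟩
      · intro h0
        simp [h.reg3, h.reg4] at h0
        apply (hconst _ _).mono le_rfl
        rintro _ rfl
        refine ⟨?_, ?_⟩
        · repeat' first | exact h | apply Layout.set _ (by omega)
        · have : s = t := by omega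
          simp [this, not_lt.1 hT]
    · omega
  · apply Runs.of_le
    · apply Runs.sub
      apply Runs.sub
      apply Runs.add
      apply Runs.last
      apply Runs.ite
      · intro hne
        simp [h.reg3, h.reg4] at hne
        have h₁ : Layout n s t a p o x (((σ.set 17 (s - t)).set 18 (t - s)).set 17
            (s - t + (t - s))) := by
          repeat' first | exact h | apply Layout.set _ (by omega)
        simp [h.reg3, h.reg4]
        apply Runs.cons
        · apply runs_adjProg h₁ (by omega) (by omega)
          · simp [h.reg3, hs]
          · simp [h.reg4, ht]
        rintro τ ⟨hf, hm, hr⟩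
        have h₂ := h₁.frame (hf.mono (by omega)) hm
        apply Runs.add
        apply Runs.nil
        refine ⟨h₂.set (by omega), ?_⟩
        simp [h.reg3, h.reg4] at hr
        simp [h₂.reg9, hr]
        constructor
        · exact fun h => ⟨fun _ => by omega, fun _ => h⟩
        · exact fun h => h.2 (not_lt.1 hT')
      · intro h0
        simp [h.reg3, h.reg4] at h0
        apply (hconst _ _).mono le_rfl
        rintro _ rfl
        refine ⟨?_, ?_⟩
        · repeat' first | exact h | apply Layout.set _ (by omega)
        · have : s = t := by omega
          simp [this, not_lt.1 hT]
    · omega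

/-- Output the array `x` behind a `1`. -/
def outProg : Program :=
  block [countdown 20 2 (block [.add 21 6 20, .load 21 21, .add 22 20 1, .store 22 21]),
    .const 21 0, .store 21 1, .add 0 2 1]

theorem runs_outProg {σ : State} (h : Layout n s t a p o x σ) :
    Runs outProg σ (20 * (n + 1)) (fun τ => output τ = 1 :: (List.range n).map x) := by
  apply Runs.of_le
  · apply Runs.cons
    · apply Runs.countdown (b := 5) (fun m τ => Frame 20 σ τ ∧
        (∀ v < n, τ.mem (3 + n * n + n + n + v) = x v) ∧
        ∀ v < n, m ≤ v → τ.mem (v + 1) = x v)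
      · rintro m τ ⟨hf, -⟩
        rw [hf 1 (by omega), h.reg1]
      · omega
      · refine ⟨(Frame.refl _ _).set (by omega), h.memx, ?_⟩
        rw [h.reg2]
        intros; omega
      · rintro m τ hm ⟨hf, hx, hmem⟩ h20
        rw [h.reg2] at hm
        apply Runs.of_le
        · apply Runs.add
          apply Runs.load
          apply Runs.add
          apply Runs.store
          apply Runs.nil
          simp [hf 6 (by omega), h.reg6, hf 1 (by omega), h.reg1, hx m hm, State.put_mem]
          refine ⟨?_, ?_, ?_⟩
          · repeat' first | exact hf | apply Frame.put | apply Frame.set | omega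
          · intro v hv
            -- The output cells are at most `n`, below the array `x`; only input that is no longer
            -- needed is overwritten.
            rw [Function.update_of_ne (by nlinarith), hx v hv]
          · intro v hv hmv
            rcases hmv.eq_or_lt with rfl | hmv
            · simp
            · rw [Function.update_of_ne (by omega), hmem v hv hmv]
        · omega
    rintro τ ⟨hf, -, hmem⟩
    apply Runs.const
    apply Runs.store
    apply Runs.add
    apply Runs.nil
    simp [output, hf 2 (by omega), h.reg2, hf 1 (by omega), h.reg1, State.put_mem,
      List.range_succ_eq_map]
    intro v hv
    exact hmem v hv (by omega)
  · rw [h.reg2]; omega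

/-- The program for the pseudocut problem with the threshold `T`. -/
noncomputable def pseudocutProg (T : ℝ) : Program :=
  block [.const 1 1, .load 2 9, .load 3 1, .const 4 2, .load 4 4, .add 5 0 2, .add 6 5 2,
    .add 7 2 1, failProg T, .ifNonzero 16 (block [.const 0 0, .store 0 0, .const 0 1])
      (block [hitProg T, outProg])]

theorem runs_pseudocutProg {T : ℝ} {w : List ℕ} (hw : w.length = 3 + n * n)
    (hn : w.getD 0 0 = n) (hs' : w.getD 1 0 = s) (ht' : w.getD 2 0 = t)
    (hadj : ∀ u < n, ∀ v < n, w.getD (3 + n * u + v) 0 = a u v) (hs : s < n)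
    (ht : t < n) (ha : ∀ u v, a u v ≤ 1) :
    Runs (pseudocutProg T) (initial w) (400 * (n + 1) ^ 5) (fun τ =>
      (¬ ((0 ≤ T → s ≠ t) ∧ (1 ≤ T → a s t = 0)) ∧ output τ = [0]) ∨
      ∃ X, IsMinHitting T n s t a X ∧
        output τ = 1 :: (List.range n).map fun v => if v ∈ X then 1 else 0) := by
  have hb : 20 * (n + 1) ^ 1 ≤ 20 * (n + 1) ^ 5 := by gcongr <;> omega
  have hb' : 0 < (n + 1) ^ 5 := by positivity
  rw [pow_one] at hb
  -- Memory behind the input is 0, so prices, owners and marks need no initialization.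
  have hzero : ∀ i, 3 + n * n ≤ i → w.getD i 0 = 0 := fun i hi =>
    List.getD_eq_default _ _ (by omega)
  apply Runs.of_le
  · apply Runs.const
    apply Runs.load
    apply Runs.load
    apply Runs.const
    apply Runs.load
    apply Runs.add
    apply Runs.add
    apply Runs.add
    have hL : Layout n s t a (fun _ => 0) (fun _ => 0) (fun _ => 0)
        ((((((((initial w).set 1 1).set 2 n).set 3 s).set 4 2).set 4 t).set 5
          (3 + n * n + n)).set 6 (3 + n * n + n + n) |>.set 7 (n + 1)) := by
      constructor <;> try simp [initial, hw]
      · exact hadj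
      all_goals
        intro v hv
        exact hzero _ (by omega)
    have e : ∀ i, (initial w).mem i = w.getD i 0 := fun _ => rfl
    have e0 : (initial w).reg 0 = 3 + n * n := by simp [initial, hw]
    have e9 : (initial w).reg 9 = 0 := by simp [initial]
    simp only [State.set_reg, State.set_mem, e, e0, e9, hn, hs', ht', reduceIte,
      Nat.reduceEqDiff]
    apply Runs.cons (runs_failProg hL hs ht (T := T))
    rintro τ ⟨hL, hr⟩
    apply Runs.last
    apply Runs.ite
    · intro hne
      -- Register 0 serves first as address and value of the written 0, then as the output length 1.
      apply Runs.const
      apply Runs.store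
      apply Runs.const
      apply Runs.nil
      refine .inl ⟨fun h => hne (hr.2 h), ?_⟩
      simp [output, State.put_mem]
    · intro h0
      obtain ⟨h0, h1⟩ := hr.1 h0
      apply Runs.cons (runs_hitProg hL hs ht ha h0 h1)
      rintro υ ⟨X, p, o, x, hX, hL, hx⟩
      apply Runs.last
      apply (runs_outProg hL).mono le_rfl
      rintro τ hτ
      refine .inr ⟨X, hX, ?_⟩
      rw [hτ]
      congr 1
      refine List.map_congr_left fun v hv => ?_
      have := hx v (List.mem_range.1 hv)
      split_ifs with hvX
      · exact this.2.2 hvX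
      · have : x v ≠ 1 := fun h => hvX (this.2.1 h)
        omega
  · omega

end RAM

/-! ### From instances and pseudocuts to matrices and hitting sets -/

theorem List.getD_flatMap_of_length {α β : Type*} (f : α → List β) (m : ℕ) (d : β) (l : List α)
    (hf : ∀ x ∈ l, (f x).length = m) {u v : ℕ} (hu : u < l.length) (hv : v < m) :
    (l.flatMap f).getD (m * u + v) d = (f l[u]).getD v d := by
  induction l generalizing u with
  | nil => simp at hu
  | cons x l ih =>
    have hx : (f x).length = m := hf x (by simp)
    rw [List.flatMap_cons]
    cases u with
    | zero => rw [Nat.mul_zero, Nat.zero_add, List.getD_append _ _ _ _ (by omega)]; rfl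
    | succ u =>
      rw [List.getD_append_right _ _ _ _ (by rw [Nat.mul_succ]; omega), hx,
        show m * (u + 1) + v - m = m * u + v by rw [Nat.mul_succ]; omega]
      exact ih (fun y hy => hf y (by simp [hy])) (by simpa using hu)

namespace PCutInstance

variable (I : PCutInstance)

open Classical in
/-- The adjacency matrix. -/
noncomputable def adjMatrix (u v : ℕ) : ℕ :=
  if ∃ (hu : u < I.n) (hv : v < I.n), I.G.Adj ⟨u, hu⟩ ⟨v, hv⟩ then 1 else 0

theorem adjMatrix_le (u v : ℕ) : I.adjMatrix u v ≤ 1 := by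
  unfold adjMatrix; split_ifs <;> omega

theorem adjMatrix_eq_one {u v : Fin I.n} : I.adjMatrix u v = 1 ↔ I.G.Adj u v := by
  simp [adjMatrix]

theorem adjMatrix_eq_zero {u v : Fin I.n} : I.adjMatrix u v = 0 ↔ ¬ I.G.Adj u v := by
  simp [adjMatrix]

theorem length_encode : I.encode.length = 3 + I.n * I.n := by
  simp [encode, List.length_flatMap]
  omega

theorem encode_getD {u v : ℕ} (hu : u < I.n) (hv : v < I.n) :
    I.encode.getD (3 + I.n * u + v) 0 = I.adjMatrix u v := by
  rw [show 3 + I.n * u + v = I.n * u + v + 1 + 1 + 1 by omega, encode]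
  simp only [List.getD_cons_succ]
  rw [List.getD_flatMap_of_length _ I.n _ _ (by simp) (by simpa using hu) hv]
  have hget : ∀ w (hw : w < I.n), (List.finRange I.n)[w]'(by simpa using hw) = ⟨w, hw⟩ :=
    fun w hw => by ext; simp
  simp [adjMatrix, hu, hv]
  rw [hget u hu, hget v hv]
  by_cases h : I.G.Adj ⟨u, hu⟩ ⟨v, hv⟩ <;> simp [h, hu, hv]

variable {I}

theorem pathLength_eq (hI : I.UniformLengths) (p : List (Fin I.n)) (hp : p.IsChain I.G.Adj) :
    I.pathLength p = ((p.length - 1 : ℕ) : ℝ) := by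
  induction p with
  | nil => simp [pathLength]
  | cons x p ih =>
    cases p with
    | nil => simp [pathLength]
    | cons y p =>
      rw [List.isChain_cons_cons] at hp
      have := ih hp.2
      simp only [pathLength, List.tail_cons, List.zipWith_cons_cons, List.sum_cons] at this ⊢
      rw [this, hI x y hp.1]
      simp
      ring

/-- The strict inequality survives the infimum because lengths are natural numbers: they are all at
least 0 if `T < 0`, and at least `⌊T⌋₊ + 1` otherwise, which in both cases is a uniform bound above
`T`. -/
theorem lt_distAfter_iff (hI : I.UniformLengths) (T : ℝ) (W : Finset (Fin I.n)) (u v : Fin I.n) :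
    (T : EReal) < I.distAfter W u v ↔
      ∀ p, I.IsPathAvoiding W u v p → T < ((p.length - 1 : ℕ) : ℝ) := by
  constructor
  · intro h p hp
    have := h.trans_le (iInf₂_le p hp)
    rwa [EReal.coe_lt_coe_iff, pathLength_eq hI p hp.2.2.1] at this
  · intro h
    by_cases hT : T < 0
    · refine lt_of_lt_of_le (b := ((0 : ℝ) : EReal)) (EReal.coe_lt_coe_iff.2 hT) ?_
      refine le_iInf₂ fun p hp => ?_
      rw [EReal.coe_le_coe_iff, pathLength_eq hI p hp.2.2.1]
      positivity
    · refine lt_of_lt_of_le (b := (((⌊T⌋₊ + 1 : ℕ) : ℝ) : EReal))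
        (EReal.coe_lt_coe_iff.2 (by push_cast; exact Nat.lt_floor_add_one T)) ?_
      refine le_iInf₂ fun p hp => ?_
      rw [EReal.coe_le_coe_iff, pathLength_eq hI p hp.2.2.1]
      exact_mod_cast (Nat.floor_lt (not_lt.1 hT)).2 (h p hp)

/-- Vertex sequences may repeat vertices, which matches `Hits`, where `u` and `v` need not be
distinct from each other or from `s` and `t`. Sequences with one to four vertices give its four
fields; five vertices already mean length at least 4, above `T`. -/
theorem isPseudocut_iff (hI : I.UniformLengths) {T : ℝ} (hT : T ≤ 3) (W : Finset (Fin I.n)) :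
    I.IsPseudocut T W ↔ I.s ∉ W ∧ I.t ∉ W ∧
      RAM.Hits T I.n I.s I.t I.adjMatrix (W.map Fin.valEmbedding) := by
  have hmem : ∀ v : Fin I.n, (v : ℕ) ∈ W.map Fin.valEmbedding ↔ v ∈ W := fun v => by
    simp [Fin.val_inj]
  rw [IsPseudocut, lt_distAfter_iff hI]
  refine and_congr_right fun hs => and_congr_right fun ht => ⟨fun h => ?_, fun h => ?_⟩
  · refine ⟨fun h0 hst => ?_, fun h1 => ?_, fun h2 v hv hsv hvt => ?_,
      fun h3 u hu v hv hsu huv hvt => ?_⟩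
    · have := h [I.s] ⟨rfl, by simp [Fin.ext hst], by simp, by simp [hs]⟩
      simp at this
      linarith
    · rw [adjMatrix_eq_zero]
      intro hst
      have := h [I.s, I.t] ⟨rfl, rfl, by simp [hst], by simp [hs, ht]⟩
      norm_num at this
      linarith
    · lift v to Fin I.n using hv
      rw [adjMatrix_eq_one] at hsv hvt
      rw [hmem]
      by_contra hW
      have := h [I.s, v, I.t] ⟨rfl, rfl, by simp [hsv, hvt], by simp [hs, ht, hW]⟩
      norm_num at this
      linarith
    · lift u to Fin I.n using hu
      lift v to Fin I.n using hv
      rw [adjMatrix_eq_one] at hsu huv hvt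
      rw [hmem, hmem]
      by_contra! hW
      have := h [I.s, u, v, I.t] ⟨rfl, rfl, by simp [hsu, huv, hvt], by simp [hs, ht, hW.1, hW.2]⟩
      norm_num at this
      linarith
  · rintro p ⟨h1, h2, h3, h4⟩
    by_contra! hle
    rcases p with _ | ⟨x, _ | ⟨y, _ | ⟨z, _ | ⟨w, _ | ⟨w', p⟩⟩⟩⟩⟩
    · simp at h1
    · simp at h1 h2 hle
      exact h.zero hle (by rw [← h1, ← h2])
    · simp at h1 h2 h3 hle
      have := h.one hle
      rw [adjMatrix_eq_zero, ← h1, ← h2] at this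
      exact this h3
    · simp at h1 h2 h3 h4
      norm_num at hle
      subst h1 h2
      have := h.two hle y y.2 (I.adjMatrix_eq_one.2 h3.1) (I.adjMatrix_eq_one.2 h3.2)
      rw [hmem] at this
      exact h4.2.1 this
    · simp at h1 h2 h3 h4
      norm_num at hle
      subst h1 h2
      have := h.three hle y y.2 z z.2 (I.adjMatrix_eq_one.2 h3.1) (I.adjMatrix_eq_one.2 h3.2.1)
        (I.adjMatrix_eq_one.2 h3.2.2)
      rw [hmem, hmem] at this
      tauto
    · simp at hle
      have : (0 : ℝ) ≤ p.length := by positivity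
      linarith

theorem isMinPseudocut_of_isMinHitting (hI : I.UniformLengths) (hc : I.UniformCosts) {T : ℝ}
    (hT : T ≤ 3) {X : Finset ℕ} (hX : RAM.IsMinHitting T I.n I.s I.t I.adjMatrix X) :
    I.IsMinPseudocut T (Finset.univ.filter fun v : Fin I.n => (v : ℕ) ∈ X) := by
  have hmem : ∀ v < I.n, v ∈ X → v ∈ (Finset.univ.filter fun v : Fin I.n => (v : ℕ) ∈ X).map
      Fin.valEmbedding := by
    intro v hv hvX
    exact Finset.mem_map.2 ⟨⟨v, hv⟩, by simpa using hvX, rfl⟩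
  -- Only an inclusion: nothing confines `X` to numbers below `n`, but dropping the others can only
  -- lower the cost.
  have hsub : (Finset.univ.filter fun v : Fin I.n => (v : ℕ) ∈ X).map Fin.valEmbedding ⊆ X := by
    intro v hv
    obtain ⟨w, hw, rfl⟩ := Finset.mem_map.1 hv
    simpa using hw
  refine ⟨(isPseudocut_iff hI hT _).2 ⟨by simpa using hX.source, by simpa using hX.target,
    hX.hits.zero, hX.hits.one, fun h v hv h1 h2 => hmem v hv (hX.hits.two h v hv h1 h2),
    fun h u hu v hv h1 h2 h3 => (hX.hits.three h u hu v hv h1 h2 h3).imp (hmem u hu) (hmem v hv)⟩,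
    fun W hW => ?_⟩
  have h1 := hX.card_le _ ((isPseudocut_iff hI hT W).1 hW).2.2
  have h2 := Finset.card_le_card hsub
  rw [Finset.card_map] at h1 h2
  have : ∀ V : Finset (Fin I.n), ∑ v ∈ V, I.cost v = V.card := fun V => by
    rw [Finset.sum_congr rfl fun v _ => hc v]; simp
  rw [this, this]
  exact_mod_cast h2.trans h1

end PCutInstance

/-! ### The polynomial time bound -/

theorem RAM.length_le_wordSize (w : List ℕ) : w.length ≤ RAM.wordSize w := by
  induction w with
  | nil => simp
  | cons x w ih =>
    simp only [RAM.wordSize, List.map_cons, List.sum_cons, List.length_cons] at ih ⊢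
    omega

theorem mainTheorem7 (T : ℝ) (hT : T ≤ 3) :
    RAM.SolvableInPolyTime (α := UniformPCutInstance)
      (β := fun I => Option (Finset (Fin I.1.n)))
      (fun I a => I.1.IsAnswer T a) (fun I => I.1.encode) (fun I a => I.1.encodeAnswer a) := by
  refine ⟨RAM.pseudocutProg T, 400 * (Polynomial.X + 1) ^ 5, ?_⟩
  rintro ⟨I, hI, hc⟩
  obtain ⟨τ, k, hexec, hk, hout⟩ := RAM.runs_pseudocutProg (T := T) (w := I.encode)
    I.length_encode rfl rfl rfl (fun u hu v hv => I.encode_getD hu hv) I.s.2 I.t.2 I.adjMatrix_le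
  refine ⟨τ, k, hexec, hk.trans ?_, ?_⟩
  -- The word has `3 + n * n` entries, each of size at least 1, so `n` is at most the input size.
  · have h1 := I.length_encode ▸ RAM.length_le_wordSize I.encode
    have h2 := Nat.le_mul_self I.n
    have h3 : I.n ≤ RAM.wordSize I.encode := by omega
    simp only [Polynomial.eval_mul, Polynomial.eval_pow, Polynomial.eval_add, Polynomial.eval_X,
      Polynomial.eval_one, Polynomial.eval_ofNat]
    gcongr
  · rcases hout with ⟨hfail, hout⟩ | ⟨X, hX, hout⟩
    · refine ⟨none, fun W hW => hfail ?_, hout⟩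
      have := ((PCutInstance.isPseudocut_iff hI hT W).1 hW).2.2
      exact ⟨this.zero, this.one⟩
    · refine ⟨some (Finset.univ.filter fun v : Fin I.n => (v : ℕ) ∈ X),
        PCutInstance.isMinPseudocut_of_isMinHitting hI hc hT hX, ?_⟩
      change _ = 1 :: (List.finRange I.n).map _
      rw [hout, ← List.map_coe_finRange_eq_range, List.map_map]
      simp
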